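/- Multigraphs are finite and may have parallel edges but no loops. For a multigraph $G$ let $\mu_G(uv)$ be the number of edges joining $u$ and $v$. For a simple graph $F$ and an integer $t\ge 1$, $F^t$ is the multigraph obtained from $F$ by replacing each edge by $t$ parallel edges; $K_n$ ($n\ge 1$) is the complete graph and $C_n$ ($n\ge 3$) the cycle on $n$ vertices. A block of $G$ is a maximal connected sub-multigraph without a cut vertex. A degree-list assignment $L$ of $G$ assigns to every vertex $u$ a finite set $L(u)$ with $|L(u)|\ge d_G(u)$ (degrees count multiplicities). A matching assignment $\mathcal M_L$ over $L$ consists, for each pair of distinct vertices $u,v$, of a union $M_{L,uv}$ of $\mu_G(uv)$ (not necessarily perfect, possibly empty) matchings between $\{u\}\times L(u)$ and $\{v\}\times L(v)$. The $\mathcal M_L$-cover of $G$ is the graph with vertex set $\{(u,c): u\in V(G),\ c\in L(u)\}$ in which every $\{u\}\times L(u)$ is a clique and, for $u\neq v$, the edges between $\{u\}\times L(u)$ and $\{v\}\times L(v)$ are those of $M_{L,uv}$. An $\mathcal M_L$-coloring of $G$ is an independent set of size $|V(G)|$ in the $\mathcal M_L$-cover. Write $[m]=\{1,\dots,m\}$.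 Define three graphs; in each of them adjacency is between distinct vertices and is symmetric. * $H(n,t)$ has vertex set $[n]\times[n-1]\times[t]$; $(i,j,k)$ and $(i',j',k')$ are adjacent iff $i=i'$ or $j=j'$. * The $t$-fat ladder of length $n$ has vertex set $[n]\times\{1,2\}\times[t]$; $(i,j,k)$ and $(i',j',k')$ are adjacent iff $i=i'$, or $j=j'$ and $i,i'$ are cyclically consecutive in $[n]$. * The $t$-fat Möbius ladder of length $n$ has vertex set $[n]\times\{1,2\}\times[t]$; $(i,j,k)$ and $(i',j',k')$ are adjacent iff $i=i'$, or $|i-i'|=1$ and $j=j'$, or $\{i,i'\}=\{1,n\}$ and $j\ne j'$ (used for $n\ge 4$). **Theorem.** Let $G$ be a connected multigraph, $L$ a degree-list assignment of $G$ and $\mathcal M_L$ a matching assignment over $L$. Then $G$ does not admit an $\mathcal M_L$-coloring if and only if each block of $G$ is isomorphic to $K_n^t$ or $C_n^t$ for some integers $n$ and $t$, and there are sets $L_B(u)$, for every block $B$ of $G$ and every vertex $u$ of $B$, such that all of the following hold. (I) For each vertex $u$ of $G$, the sets $L_B(u)$, where $B$ ranges over the blocks containing $u$, are pairwise disjoint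 and have union $L(u)$; moreover $|L_B(u)|=t(n-1)$ if $B$ is isomorphic to $K_n^t$, and $|L_B(u)|=2t$ if $B$ is isomorphic to $C_n^t$. (II) If $B$ is a block isomorphic to $K_n^t$, then $\bigcup_{u\in V(B)}\{u\}\times L_B(u)$ induces in the $\mathcal M_L$-cover a graph isomorphic to $H(n,t)$, by an isomorphism under which each set $\{u\}\times L_B(u)$ corresponds to $\{i_u\}\times[n-1]\times[t]$ for some $i_u\in[n]$. (III) If $B$ is a block isomorphic to $C_n^t$ with $n$ odd, then $\bigcup_{u\in V(B)}\{u\}\times L_B(u)$ induces in the $\mathcal M_L$-cover a $t$-fat ladder of length $n$, by an isomorphism under which each set $\{u\}\times L_B(u)$ corresponds to $\{i_u\}\times\{1,2\}\times[t]$ for some $i_u\in[n]$. (IV) If $B$ is a block isomorphic to $C_n^t$ with $n$ even, then $\bigcup_{u\in V(B)}\{u\}\times L_B(u)$ induces in the $\mathcal M_L$-cover a $t$-fat Möbius ladder of length $n$, by an isomorphism under which each set $\{u\}\times L_B(u)$ corresponds to $\{i_u\}\times\{1,2\}\times[t]$ for some $i_u\in[n]$. -/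

import Mathlib

/-- A multigraph on the vertex set `V`: multiple edges are allowed, loops are not. It is given by
the number `mult u v` of edges joining `u` and `v`. -/
structure Multigraph (V : Type*) where
  mult : V → V → ℕ
  symm : ∀ u v, mult u v = mult v u
  loopless : ∀ v, mult v v = 0

namespace Multigraph

variable {V W C : Type*}

/-- The underlying simple graph: two vertices are adjacent iff at least one edge joins them. -/
def toSimpleGraph (G : Multigraph V) : SimpleGraph V where
  Adj u v := G.mult u v ≠ 0
  symm := ⟨fun u v h => by rwa [G.symm v u]⟩
  loopless := ⟨fun v h => h (G.loopless v)⟩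

/-- A multigraph is connected iff its underlying simple graph is (in particular it is nonempty). -/
def Connected (G : Multigraph V) : Prop := G.toSimpleGraph.Connected

/-- The degree of a vertex: the number of edges incident with it, counted with multiplicity. -/
def degree [Fintype V] (G : Multigraph V) (u : V) : ℕ := ∑ v, G.mult u v

/-- The sub-multigraph induced by a set of vertices. -/
def induce (G : Multigraph V) (B : Set V) : Multigraph B where
  mult u v := G.mult u v
  symm u v := G.symm u v
  loopless v := G.loopless v

open Classical in
/-- A simple graph, seen as a multigraph. -/
noncomputable def ofSimpleGraph (S : SimpleGraph V) : Multigraph V where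
  mult u v := if S.Adj u v then 1 else 0
  symm u v := by simp only [S.adj_comm u v]
  loopless v := if_neg (S.irrefl)

/-- The multigraph `G^t`: every edge of `G` is replaced by `t` parallel edges. -/
def fatten (G : Multigraph V) (t : ℕ) : Multigraph V where
  mult u v := t * G.mult u v
  symm u v := by rw [G.symm u v]
  loopless v := by rw [G.loopless v, mul_zero]

/-- Two multigraphs are isomorphic: there is a bijection between the vertex sets that preserves
the multiplicities. -/
def Isomorphic (G : Multigraph V) (H : Multigraph W) : Prop :=
  ∃ e : V ≃ W, ∀ u v, H.mult (e u) (e v) = G.mult u v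

/-- `K_n^t`. -/
noncomputable def completePow (n t : ℕ) : Multigraph (Fin n) :=
  (ofSimpleGraph (⊤ : SimpleGraph (Fin n))).fatten t

/-- `C_n^t` (used only for `n ≥ 3`). -/
noncomputable def cyclePow (n t : ℕ) : Multigraph (Fin n) :=
  (ofSimpleGraph (SimpleGraph.cycleGraph n)).fatten t

/-- The set `B` induces a connected sub-multigraph without cut vertices. -/
def IsNonseparable (G : Multigraph V) (B : Set V) : Prop :=
  (G.toSimpleGraph.induce B).Connected ∧
    ∀ v ∈ B, (G.toSimpleGraph.induce (B \ {v})).Preconnected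

/-- `B` is the vertex set of a block of `G`, a block being a maximal connected sub-multigraph
without cut vertices. A block is an induced sub-multigraph, so it is determined by its vertex set;
the block itself is `G.induce B`. -/
def IsBlock (G : Multigraph V) (B : Set V) : Prop := Maximal G.IsNonseparable B

/-- The block with vertex set `B` is isomorphic to `K_n^t`, where `n, t ≥ 1`. -/
def IsCompleteBlock (G : Multigraph V) (B : Set V) (n t : ℕ) : Prop :=
  1 ≤ n ∧ 1 ≤ t ∧ (G.induce B).Isomorphic (completePow n t)

/-- The block with vertex set `B` is isomorphic to `C_n^t`, where `n ≥ 3` and `t ≥ 1`. -/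
def IsCycleBlock (G : Multigraph V) (B : Set V) (n t : ℕ) : Prop :=
  3 ≤ n ∧ 1 ≤ t ∧ (G.induce B).Isomorphic (cyclePow n t)

/-- `L` is a degree-list assignment of `G`: `|L(u)| ≥ d_G(u)` for each vertex `u`. -/
def IsDegreeList [Fintype V] (G : Multigraph V) (L : V → Finset C) : Prop :=
  ∀ u, G.degree u ≤ (L u).card

/-- A matching assignment over the list assignment `L` of `G`. For vertices `u` and `v`,
`Rel u v c d` says that `(u, c)(v, d)` is an edge of `M_{L,uv}`, and `M_{L,uv}` is the union of
`mult u v` (not necessarily perfect, possibly empty) matchings between `{u} × L(u)` and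
`{v} × L(v)`. -/
structure MatchingAssignment (G : Multigraph V) (L : V → Finset C) where
  Rel : (u v : V) → L u → L v → Prop
  symm : ∀ u v c d, Rel u v c d → Rel v u d c
  isUnion : ∀ u v, ∃ N : Fin (G.mult u v) → L u → L v → Prop,
    (∀ i, Relator.BiUnique (N i)) ∧ ∀ c d, Rel u v c d ↔ ∃ i, N i c d

namespace MatchingAssignment

variable {G : Multigraph V} {L : V → Finset C}

/-- The `M_L`-cover of `G`: its vertices are the pairs `(u, c)` with `c ∈ L(u)`, each
`{u} × L(u)` is a clique, and the edges between `{u} × L(u)` and `{v} × L(v)` for `u ≠ v` are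
those of `M_{L,uv}`. -/
def cover (M : MatchingAssignment G L) : SimpleGraph (Σ u, L u) where
  Adj x y := x ≠ y ∧ (x.1 = y.1 ∨ M.Rel x.1 y.1 x.2 y.2)
  symm := ⟨fun x y h => ⟨h.1.symm, h.2.imp Eq.symm (M.symm x.1 y.1 x.2 y.2)⟩⟩
  loopless := ⟨fun _ h => h.1 rfl⟩

/-- `G` admits an `M_L`-coloring: the `M_L`-cover has an independent set of size `|V(G)|`. -/
def Colorable [Fintype V] (M : MatchingAssignment G L) : Prop :=
  ∃ I : Finset (Σ u, L u), M.cover.IsIndepSet (I : Set (Σ u, L u)) ∧ I.card = Fintype.card V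

/-- Given sets `L_B(u)` of colors for `u ∈ B`, this is the set `⋃_{u ∈ B} {u} × L_B(u)` of
vertices of the cover. -/
def part (_M : MatchingAssignment G L) (B : Set V) (LB : V → Finset C) : Set (Σ u, L u) :=
  {x | x.1 ∈ B ∧ (x.2 : C) ∈ LB x.1}

/-- The set `⋃_{u ∈ B} {u} × L_B(u)` induces in the cover a graph isomorphic to `K`, where each
set `{u} × L_B(u)` corresponds to the set of all vertices of `K` with first coordinate `i_u`, for
some `i_u`. -/
def Induces (M : MatchingAssignment G L) (B : Set V) (LB : V → Finset C) {n : ℕ} {J : Type*}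
    (K : SimpleGraph (Fin n × J)) : Prop :=
  ∃ e : M.cover.induce (M.part B LB) ≃g K,
    ∀ u ∈ B, ∃ i : Fin n, e '' {x | x.1.1 = u} = {p | p.1 = i}

end MatchingAssignment

end Multigraph

/-- The graph `H(n, t)`: distinct `(i, j, k)` and `(i', j', k')` are adjacent iff `i = i'` or
`j = j'`. -/
def graphH (n t : ℕ) : SimpleGraph (Fin n × (Fin (n - 1) × Fin t)) :=
  SimpleGraph.fromRel fun x y => x.1 = y.1 ∨ x.2.1 = y.2.1

/-- The `t`-fat ladder of length `n`: distinct `(i, j, k)` and `(i', j', k')` are adjacent iff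
`i = i'`, or `i'` is the cyclic successor of `i` (or vice versa) and `j = j'`. -/
def fatLadder (n t : ℕ) : SimpleGraph (Fin n × (Fin 2 × Fin t)) :=
  SimpleGraph.fromRel fun x y =>
    x.1 = y.1 ∨ ((y.1 : ℕ) = ((x.1 : ℕ) + 1) % n ∧ x.2.1 = y.2.1)

/-- The `t`-fat Möbius ladder of length `n`: as the `t`-fat ladder, except that between the last
and the first value of `i` adjacency requires `j ≠ j'`. -/
def fatMobiusLadder (n t : ℕ) : SimpleGraph (Fin n × (Fin 2 × Fin t)) :=
  SimpleGraph.fromRel fun x y =>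
    x.1 = y.1 ∨ ((y.1 : ℕ) = (x.1 : ℕ) + 1 ∧ x.2.1 = y.2.1) ∨
      ((x.1 : ℕ) + 1 = n ∧ (y.1 : ℕ) = 0 ∧ x.2.1 ≠ y.2.1)

/-! Colors are compared through a symmetric conflict relation `R` in which a color of `u` conflicts
with at most `mult u v` colors of `v`. If a connected set carries lists at least as large as the
degrees and one vertex has a surplus, greedy coloring succeeds
(`IsConflict.hasColoring_of_surplus`). Everything in the forward direction is extracted from this
fact.

If there is no coloring and `v` is a cut vertex, call a color of `v` bad for a side if it does not
extend to that side. Every color of `v` is bad for some side, since otherwise two colorings could be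
glued. A side has at most as many bad colors as `v` has degree into it, since otherwise there would
be a surplus. Hence the bad colors partition `L v`, and induction distributes the lists over the
blocks (`IsConflict.exists_block_lists`), leaving an uncolorable, or tight, instance on each block.

In a tight instance list sizes equal degrees, and each color of `u` conflicts with exactly `mult u
v` colors of `v`. If removing `x` and `y` leaves the block connected, then colors of `x` and `y`
that conflict with a common color of a third vertex conflict with each other: otherwise using both
would create a surplus (`IsTight.rel_of_rel`). With Lovász's lemma (`NonsepOn.exists_triple`) this
makes the block complete or of maximum degree at most two, hence a cycle in the noncomplete case. On
a complete block the same principle makes conflict transitive, and its classes are the columns of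
`graphH` (`IsTight.exists_classes`). On a longer cycle each list splits into two halves, and each
edge joins equal or opposite halves. Relabeling the halves along the cycle moves all twists to the
closing edge, whose type is forced by parity because otherwise alternating halves would give a
coloring (`IsTight.exists_sides`).

Conversely, a coloring selects at each vertex the block whose list contains its color. The tree
structure of the blocks yields one block selected by all its vertices (`ConnOn.exists_full_block`).
The coloring would then give an independent transversal of its model graph, which is excluded by
pigeonhole for `graphH` and by parity for the ladders. -/

namespace Multigraph

/-! ### Connectedness through cuts, Lovász's lemma, and recognition of paths and cycles. -/

section Connectivity

open scoped Classical

variable {V : Type*} {H : SimpleGraph V} {S T A D : Finset V} {u v w x y : V}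

/-- No vertex of `A` has a neighbor in `T` outside `A`. -/
def ClosedIn (H : SimpleGraph V) (T A : Finset V) : Prop :=
  ∀ a ∈ A, ∀ b ∈ T, H.Adj a b → b ∈ A

/-- The finite set `T` induces a preconnected subgraph, expressed in terms of cuts. -/
def ConnOn (H : SimpleGraph V) (T : Finset V) : Prop :=
  ∀ A ⊆ T, ClosedIn H T A → A = ∅ ∨ A = T

/-- The finite set `S` induces a connected subgraph without cut vertices. -/
def NonsepOn (H : SimpleGraph V) (S : Finset V) : Prop :=
  S.Nonempty ∧ ConnOn H S ∧ ∀ v ∈ S, ConnOn H (S.erase v)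

theorem ClosedIn.sdiff (h : ClosedIn H T A) : ClosedIn H T (T \ A) := by
  intro a ha b hb hab
  rw [Finset.mem_sdiff] at ha ⊢
  exact ⟨hb, fun hbA => ha.2 (h b hbA a ha.1 hab.symm)⟩

/-- Complements of closed sets are closed, so it suffices to test the closed sets missing one fixed
vertex. -/
theorem connOn_iff_of_mem (hw : w ∈ T) :
    ConnOn H T ↔ ∀ A ⊆ T, ClosedIn H T A → w ∉ A → A = ∅ := by
  constructor
  · intro h A hA hc hwA
    rcases h A hA hc with h | h
    · exact h
    · exact absurd (h ▸ hw) hwA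
  · intro h A hA hc
    by_cases hwA : w ∈ A
    · right
      have := h (T \ A) Finset.sdiff_subset hc.sdiff (by simp [hwA])
      exact Finset.Subset.antisymm hA (Finset.sdiff_eq_empty_iff_subset.1 this)
    · exact Or.inl (h A hA hc hwA)

theorem ConnOn.exists_adj (h : ConnOn H T) (hA : A ⊆ T) (hne : A.Nonempty) (hT : A ≠ T) :
    ∃ a ∈ A, ∃ b ∈ T, b ∉ A ∧ H.Adj a b := by
  by_contra hcon
  push Not at hcon
  rcases h A hA (fun a ha b hb hab => by
    by_contra hbA
    exact hcon a ha b hb hbA hab) with h | h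
  · exact hne.ne_empty h
  · exact hT h

theorem connOn_of_card_le_one (h : T.card ≤ 1) : ConnOn H T := by
  intro A hA _
  rcases A.eq_empty_or_nonempty with h0 | h0
  · exact Or.inl h0
  · exact Or.inr (Finset.eq_of_subset_of_card_le hA (h.trans h0.card_pos))

theorem ConnOn.exists_adj_of_mem (h : ConnOn H T) (hu : u ∈ T) (hT : 2 ≤ T.card) :
    ∃ v ∈ T, H.Adj u v := by
  obtain ⟨a, ha, b, hb, -, hab⟩ := h.exists_adj (A := {u}) (by simpa using hu) (by simp)
    (by rintro rfl; simp at hT)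
  rw [Finset.mem_singleton] at ha
  exact ⟨b, hb, ha ▸ hab⟩

theorem connOn_of_forall_adj (hu : u ∈ T) (h : ∀ v ∈ T, v ≠ u → H.Adj u v) : ConnOn H T := by
  rw [connOn_iff_of_mem hu]
  intro A hA hc huA
  by_contra hne
  obtain ⟨a, ha⟩ := Finset.nonempty_iff_ne_empty.2 hne
  exact huA (hc a ha u hu (h a (hA ha) (fun e => huA (e ▸ ha))).symm)

theorem ConnOn.insert_of_adj (h : ConnOn H T) (hv : v ∈ T) (huv : H.Adj u v) :
    ConnOn H (insert u T) := by
  rw [connOn_iff_of_mem (Finset.mem_insert_of_mem hv)]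
  intro A hA hc hvA
  have huA : u ∉ A := fun hu => hvA (hc u hu v (Finset.mem_insert_of_mem hv) huv)
  have hAT : A ⊆ T := by
    intro a ha
    rcases Finset.mem_insert.1 (hA ha) with rfl | h
    · exact absurd ha huA
    · exact h
  exact (connOn_iff_of_mem hv).1 h A hAT
    (fun a ha b hb => hc a ha b (Finset.mem_insert_of_mem hb)) hvA

/-- Removing a vertex with only one neighbor preserves connectedness. -/
theorem ConnOn.erase_leaf (h : ConnOn H T) (hv : v ∈ T) (hvu : v ≠ u)
    (hleaf : ∀ x ∈ T, H.Adj u x → x = v) : ConnOn H (T.erase u) := by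
  have hv' : v ∈ T.erase u := Finset.mem_erase.2 ⟨hvu, hv⟩
  rw [connOn_iff_of_mem hv']
  intro A hA hc hvA
  refine (connOn_iff_of_mem hv).1 h A (hA.trans (Finset.erase_subset _ _)) ?_ hvA
  intro a ha b hb hab
  by_cases hbu : b = u
  · subst hbu
    have := hleaf a (Finset.mem_of_mem_erase (hA ha)) hab.symm
    exact absurd (this ▸ ha) hvA
  · exact hc a ha b (Finset.mem_erase.2 ⟨hbu, hb⟩) hab

/-- If `D` is a union of components of `T - w`, then some such set inside `D` (for a possibly
different vertex `w`) contains no cut vertex of `T`. -/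
theorem ConnOn.exists_end (hT : ConnOn H T) :
    ∀ (k : ℕ) (w : V) (D : Finset V), D.card ≤ k → w ∈ T → D ⊆ T.erase w → D.Nonempty →
      ClosedIn H (T.erase w) D →
      ∃ w' ∈ T, ∃ D' ⊆ D, D' ⊆ T.erase w' ∧ D'.Nonempty ∧ ClosedIn H (T.erase w') D' ∧
        ∀ x ∈ D', ConnOn H (T.erase x) := by
  intro k
  induction k with
  | zero =>
    intro w D hk _ _ hne _
    exact absurd hne.card_pos (by omega)
  | succ k ih =>
    intro w D hk hw hD hne hc
    by_cases hall : ∀ x ∈ D, ConnOn H (T.erase x)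
    · exact ⟨w, hw, D, subset_rfl, hD, hne, hc, hall⟩
    push Not at hall
    obtain ⟨x, hxD, hx⟩ := hall
    have hxT := Finset.mem_of_mem_erase (hD hxD)
    have hwD : w ∉ D := fun h => (Finset.mem_erase.1 (hD h)).1 rfl
    have hwx : w ≠ x := fun h => hwD (h ▸ hxD)
    rw [connOn_iff_of_mem (Finset.mem_erase.2 ⟨hwx, hw⟩)] at hx
    push Not at hx
    obtain ⟨A, hA, hAc, hwA, hAne⟩ := hx
    have hxA : x ∉ A := fun h => (Finset.mem_erase.1 (hA h)).1 rfl
    -- If `A` meets `D`, then `A ∩ D` is a smaller closed part of `T - x`, and the induction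
    -- continues with `x` in place of `w`. If not, `x` has no neighbor in `A`, because such a
    -- neighbor would lie in `D`; then `A` is closed in `T`, against connectedness.
    by_cases hAD : (A ∩ D).Nonempty
    · have hlt : (A ∩ D).card < D.card := by
        refine Finset.card_lt_card ⟨Finset.inter_subset_right, fun h => hxA ?_⟩
        exact Finset.mem_of_mem_inter_left (h hxD)
      obtain ⟨w', hw', D', hD', h⟩ := ih x (A ∩ D) (by omega) hxT
        (Finset.inter_subset_left.trans hA) hAD (by
          intro a ha b hb hab
          rw [Finset.mem_inter] at ha ⊢
          have hbA := hAc a ha.1 b hb hab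
          refine ⟨hbA, hc a ha.2 b (Finset.mem_erase.2 ⟨?_, Finset.mem_of_mem_erase hb⟩) hab⟩
          rintro rfl
          exact hwA hbA)
      exact ⟨w', hw', D', hD'.trans Finset.inter_subset_right, h⟩
    · exfalso
      apply hAne.ne_empty
      refine (connOn_iff_of_mem hw).1 hT A (hA.trans (Finset.erase_subset _ _)) ?_ hwA
      intro a ha b hb hab
      by_cases hbx : b = x
      · subst hbx
        exfalso
        apply hAD
        refine ⟨a, Finset.mem_inter.2 ⟨ha, hc b hxD a (Finset.mem_erase.2 ⟨?_, ?_⟩) hab.symm⟩⟩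
        · rintro rfl
          exact hwA ha
        · exact Finset.mem_of_mem_erase (hA ha)
      · exact hAc a ha b (Finset.mem_erase.2 ⟨hbx, hb⟩) hab

/-- Two nonadjacent neighbors of `u` whose removal leaves `S` connected, when `S - u` has a cut
vertex and `u` has at least three neighbors. -/
theorem NonsepOn.exists_triple_of_separable (hS : NonsepOn H S) (hu : u ∈ S)
    (hdeg : 3 ≤ (S.filter (H.Adj u)).card) (hw : w ∈ S.erase u)
    (hsep : ¬ ConnOn H ((S.erase u).erase w)) :
    ∃ x ∈ S, ∃ y ∈ S, x ≠ y ∧ H.Adj u x ∧ H.Adj u y ∧ ¬ H.Adj x y ∧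
      ConnOn H ((S.erase x).erase y) := by
  set T := S.erase u with hTdef
  have hT : ConnOn H T := hS.2.2 u hu
  have hTS : T ⊆ S := Finset.erase_subset _ _
  have huT : u ∉ T := Finset.notMem_erase _ _
  unfold ConnOn at hsep
  push Not at hsep
  obtain ⟨D₁, hD₁, hc₁, hne₁, hne₁'⟩ := hsep
  -- Each side of the cut vertex `w` contains a neighbor of `u` that is not a cut vertex of `T`.
  -- Otherwise an end inside that side has no neighbor of `u` and stays closed in `S - w'`, so `w'`
  -- would be a cut vertex of `S`.
  have key : ∀ D ⊆ T.erase w, D.Nonempty → ClosedIn H (T.erase w) D →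
      ∃ x ∈ D, H.Adj u x ∧ ConnOn H (T.erase x) := by
    intro D hD hne hc
    obtain ⟨w', hw', D', hD'D, hD', hne', hc', hall⟩ :=
      hT.exists_end D.card w D le_rfl hw hD hne hc
    by_contra hcon
    push Not at hcon
    have hnadj : ∀ x ∈ D', ¬ H.Adj u x := fun x hx h => hcon x (hD'D hx) h (hall x hx)
    have hu' : u ∈ S.erase w' := Finset.mem_erase.2 ⟨fun h => huT (h ▸ hw'), hu⟩
    have := (connOn_iff_of_mem hu').1 (hS.2.2 w' (hTS hw')) D'
      (hD'.trans (Finset.erase_subset_erase _ hTS)) (by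
        intro a ha b hb hab
        refine hc' a ha b (Finset.mem_erase.2 ⟨(Finset.mem_erase.1 hb).1,
          Finset.mem_erase.2 ⟨?_, (Finset.mem_erase.1 hb).2⟩⟩) hab
        rintro rfl
        exact hnadj a ha hab.symm)
      (fun h => huT (Finset.mem_of_mem_erase (hD' h)))
    exact hne'.ne_empty this
  set D₂ := T.erase w \ D₁ with hD₂
  have hc₂ : ClosedIn H (T.erase w) D₂ := hc₁.sdiff
  have hne₂ : D₂.Nonempty := by
    rw [Finset.nonempty_iff_ne_empty]
    intro h
    exact hne₁' (Finset.Subset.antisymm hD₁ (Finset.sdiff_eq_empty_iff_subset.1 h))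
  obtain ⟨x, hx, hux, hxc⟩ := key D₁ hD₁ hne₁ hc₁
  obtain ⟨y, hy, huy, hyc⟩ := key D₂ Finset.sdiff_subset hne₂ hc₂
  have hyD₁ : y ∉ D₁ := (Finset.mem_sdiff.1 hy).2
  have hxD₂ : x ∉ D₂ := fun h => (Finset.mem_sdiff.1 h).2 hx
  have hxw := (Finset.mem_erase.1 (hD₁ hx)).1
  have hyw := (Finset.mem_erase.1 (Finset.sdiff_subset hy)).1
  have hxT := Finset.mem_of_mem_erase (hD₁ hx)
  have hyT := Finset.mem_of_mem_erase (Finset.sdiff_subset hy)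
  have hxy : x ≠ y := fun h => hyD₁ (h ▸ hx)
  refine ⟨x, hTS hxT, y, hTS hyT, hxy, hux, huy, fun h => hyD₁ (hc₁ x hx y
    (Finset.sdiff_subset hy) h), ?_⟩
  have hconn : ConnOn H ((T.erase x).erase y) := by
    have hw' : w ∈ (T.erase x).erase y :=
      Finset.mem_erase.2 ⟨hyw.symm, Finset.mem_erase.2 ⟨hxw.symm, hw⟩⟩
    rw [connOn_iff_of_mem hw']
    intro A hA hAc hwA
    have hAT : A ⊆ T := fun a ha => Finset.mem_of_mem_erase (Finset.mem_of_mem_erase (hA ha))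
    -- Here `z` is the vertex removed from side `D` and `z'` the one removed from the other side. As
    -- `D` has no edge to `z'`, the set `A ∩ D` is closed already in the connected set `T - z`.
    have sub : ∀ D z z', ClosedIn H (T.erase w) D → z' ∉ D → z' ≠ w → z ∈ T → z ≠ w →
        (∀ b ∈ T, b ≠ z → b ≠ z' → b ∈ (T.erase x).erase y) → (z ∉ A) →
        ConnOn H (T.erase z) → A ∩ D = ∅ := by
      intro D z z' hD hz' hz'w hzT hzw hsub hzA hzc
      refine (connOn_iff_of_mem (Finset.mem_erase.2 ⟨hzw.symm, hw⟩)).1 hzc _ ?_ ?_ ?_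
      · intro a ha
        have := Finset.mem_of_mem_inter_left ha
        exact Finset.mem_erase.2 ⟨fun h => hzA (h ▸ this), hAT this⟩
      · intro a ha b hb hab
        rw [Finset.mem_inter] at ha ⊢
        rw [Finset.mem_erase] at hb
        have hbD : b ≠ w → b ∈ D := fun h => hD a ha.2 b (Finset.mem_erase.2 ⟨h, hb.2⟩) hab
        have hbz' : b ≠ z' := by
          rintro rfl
          exact hz' (hbD hz'w)
        have hbA := hAc a ha.1 b (hsub b hb.2 hb.1 hbz') hab
        exact ⟨hbA, hbD fun h => hwA (h ▸ hbA)⟩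
      · exact fun h => hwA (Finset.mem_of_mem_inter_left h)
    have hxA : x ∉ A := fun h => by simpa using hA h
    have hyA : y ∉ A := fun h => by simpa using hA h
    have h1 := sub D₁ x y hc₁ hyD₁ hyw hxT hxw (fun b hb h1 h2 => by simp [hb, h1, h2]) hxA hxc
    have h2 := sub D₂ y x hc₂ hxD₂ hxw hyT hyw (fun b hb h1 h2 => by simp [hb, h1, h2]) hyA hyc
    rw [Finset.eq_empty_iff_forall_notMem]
    intro a ha
    by_cases haD : a ∈ D₁
    · exact Finset.notMem_empty a (h1 ▸ Finset.mem_inter.2 ⟨ha, haD⟩)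
    · refine Finset.notMem_empty a (h2 ▸ Finset.mem_inter.2 ⟨ha, Finset.mem_sdiff.2 ⟨?_, haD⟩⟩)
      exact Finset.mem_erase.2 ⟨fun h => hwA (h ▸ ha), hAT ha⟩
  -- The third neighbor of `u` is what attaches `u` to `T - x - y`.
  obtain ⟨z, hz, hzxy⟩ : ∃ z ∈ S.filter (H.Adj u), z ∉ ({x, y} : Finset V) := by
    by_contra hcon
    push Not at hcon
    have := Finset.card_le_card (show S.filter (H.Adj u) ⊆ {x, y} from hcon)
    have := this.trans Finset.card_le_two
    omega
  simp only [Finset.mem_insert, Finset.mem_singleton, not_or, Finset.mem_filter] at hz hzxy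
  have := hconn.insert_of_adj (v := z) (u := u) (by
    simp [hzxy.1, hzxy.2, hTdef, hz.1, hz.2.ne']) hz.2
  convert this using 1
  ext b
  simp only [hTdef, Finset.mem_erase, Finset.mem_insert]
  constructor
  · rintro ⟨h1, h2, h3⟩
    by_cases h : b = u
    · exact Or.inl h
    · exact Or.inr ⟨h1, h2, h, h3⟩
  · rintro (rfl | ⟨h1, h2, h, h3⟩)
    · exact ⟨huy.ne, hux.ne, hu⟩
    · exact ⟨h1, h2, h3⟩

/-- Lovász's lemma: a nonseparable set that is not complete and has a vertex with at least three
neighbors contains a vertex with two nonadjacent neighbors whose removal keeps it connected. -/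
theorem NonsepOn.exists_triple (hS : NonsepOn H S) (hu : u ∈ S)
    (hdeg : 3 ≤ (S.filter (H.Adj u)).card)
    (hx : x ∈ S) (hy : y ∈ S) (hxy : x ≠ y) (hnadj : ¬ H.Adj x y) :
    ∃ v ∈ S, ∃ x ∈ S, ∃ y ∈ S, x ≠ y ∧ H.Adj v x ∧ H.Adj v y ∧ ¬ H.Adj x y ∧
      ConnOn H ((S.erase x).erase y) := by
  by_cases hsep : ∀ w ∈ S.erase u, ConnOn H ((S.erase u).erase w)
  · by_cases hdom : ∀ v ∈ S, v ≠ u → H.Adj u v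
    · have hxu : x ≠ u := by
        rintro rfl
        exact hnadj (hdom y hy hxy.symm)
      have hyu : y ≠ u := by
        rintro rfl
        exact hnadj (hdom x hx hxy).symm
      refine ⟨u, hu, x, hx, y, hy, hxy, hdom x hx hxu, hdom y hy hyu, hnadj, ?_⟩
      exact connOn_of_forall_adj (by simp [hxu.symm, hyu.symm, hu])
        (fun v hv => hdom v (Finset.mem_of_mem_erase (Finset.mem_of_mem_erase hv)))
    -- A vertex `w` at distance two from `u` is chosen: `u` and `w` are then nonadjacent with a
    -- common neighbor `v`, and `S - u - w` is connected by the case assumption.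
    · push Not at hdom
      obtain ⟨z, hz, hzu, hzadj⟩ := hdom
      obtain ⟨v, hv, w, hw, hwN, hvw⟩ := hS.2.1.exists_adj
        (A := insert u (S.filter (H.Adj u)))
        (Finset.insert_subset hu (Finset.filter_subset _ _)) (Finset.insert_nonempty _ _)
        (fun h => by
          have := h ▸ hz
          simp [hzu, hzadj] at this)
      simp only [Finset.mem_insert, Finset.mem_filter, not_or, not_and] at hv hwN
      rcases hv with rfl | hv
      · exact absurd hvw (hwN.2 hw)
      · exact ⟨v, hv.1, u, hu, w, hw, fun h => hwN.1 h.symm, hv.2.symm, hvw, hwN.2 hw,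
          hsep w (Finset.mem_erase.2 ⟨hwN.1, hw⟩)⟩
  · push Not at hsep
    obtain ⟨w, hw, hsep⟩ := hsep
    exact ⟨u, hu, hS.exists_triple_of_separable hu hdeg hw hsep⟩

/-- A connected set with maximum degree at most two and an end vertex is a path. -/
theorem ConnOn.exists_path_index :
    ∀ (k : ℕ) (T : Finset V) (u : V), T.card = k → ConnOn H T → u ∈ T →
      (∀ v ∈ T, (T.filter (H.Adj v)).card ≤ 2) → (T.filter (H.Adj u)).card ≤ 1 →
      ∃ g : V → ℕ, Set.InjOn g T ∧ (∀ v ∈ T, g v < T.card) ∧ g u = 0 ∧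
        ∀ a ∈ T, ∀ b ∈ T, (H.Adj a b ↔ g a = g b + 1 ∨ g b = g a + 1) := by
  intro k
  induction k with
  | zero =>
    intro T u hk _ hu
    exact absurd hk (Finset.card_ne_zero_of_mem hu)
  | succ k ih =>
    intro T u hk hT hu hdeg hend
    by_cases hk0 : k = 0
    · have : T = {u} := by
        obtain ⟨z, rfl⟩ := Finset.card_eq_one.1 (by omega : T.card = 1)
        rw [Finset.mem_singleton.1 hu]
      subst this
      exact ⟨fun _ => 0, by simp, by simp, rfl, by simp⟩
    obtain ⟨v, hv, huv⟩ := hT.exists_adj_of_mem hu (by omega)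
    have hleaf : ∀ x ∈ T, H.Adj u x → x = v := fun x hx hux =>
      Finset.card_le_one.1 hend x (by simp [hx, hux]) v (by simp [hv, huv])
    have hv' : v ∈ T.erase u := Finset.mem_erase.2 ⟨huv.ne', hv⟩
    have hcard : (T.erase u).card = k := by rw [Finset.card_erase_of_mem hu]; omega
    have hsub : ∀ z, (T.erase u).filter (H.Adj z) ⊆ T.filter (H.Adj z) := fun z =>
      Finset.filter_subset_filter _ (Finset.erase_subset _ _)
    obtain ⟨g, hinj, hlt, h0, hadj⟩ := ih (T.erase u) v hcard (hT.erase_leaf hv huv.ne' hleaf) hv'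
      (fun z hz => (Finset.card_le_card (hsub z)).trans (hdeg z (Finset.mem_of_mem_erase hz)))
      (by
        have : ((T.erase u).filter (H.Adj v)).card < (T.filter (H.Adj v)).card := by
          refine Finset.card_lt_card ⟨hsub v, fun h => ?_⟩
          have := h (Finset.mem_filter.2 ⟨hu, huv.symm⟩)
          simp at this
        have := hdeg v hv
        omega)
    have huadj : ∀ z ∈ T, z ≠ u → (H.Adj u z ↔ g z = 0) := by
      intro z hz hzu
      constructor
      · intro h
        rw [hleaf z hz h, h0]
      · intro h
        rw [← h0] at h
        rwa [hinj (Finset.mem_coe.2 (Finset.mem_erase.2 ⟨hzu, hz⟩)) hv' h]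
    refine ⟨fun z => if z = u then 0 else g z + 1, ?_, ?_, by simp, ?_⟩
    · intro a ha b hb hab
      by_cases hau : a = u <;> by_cases hbu : b = u <;> simp [hau, hbu] at hab ⊢
      exact hinj (Finset.mem_coe.2 (Finset.mem_erase.2 ⟨hau, ha⟩))
        (Finset.mem_coe.2 (Finset.mem_erase.2 ⟨hbu, hb⟩)) hab
    · intro z hz
      by_cases hzu : z = u
      · simp [hzu, hk]
      · have := hlt z (Finset.mem_erase.2 ⟨hzu, hz⟩)
        simp only [hzu, if_false]
        omega
    · intro a ha b hb
      by_cases hau : a = u <;> by_cases hbu : b = u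
      · simp [hau, hbu]
      · subst hau
        simp [hbu, huadj b hb hbu]
      · subst hbu
        simp [hau, H.adj_comm a b, huadj a ha hau]
      · simp [hau, hbu, hadj a (Finset.mem_erase.2 ⟨hau, ha⟩) b (Finset.mem_erase.2 ⟨hbu, hb⟩)]

/-- In a nonseparable set with at least three vertices, every vertex has two neighbors. -/
theorem NonsepOn.exists_two_adj (hS : NonsepOn H S) (h3 : 3 ≤ S.card) (hu : u ∈ S) :
    ∃ x ∈ S, ∃ y ∈ S, x ≠ y ∧ H.Adj u x ∧ H.Adj u y := by
  obtain ⟨x, hx, hux⟩ := hS.2.1.exists_adj_of_mem hu (by omega)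
  have hcard : (S.erase x).card = S.card - 1 := Finset.card_erase_of_mem hx
  obtain ⟨y, hy, huy⟩ := (hS.2.2 x hx).exists_adj_of_mem
    (Finset.mem_erase.2 ⟨hux.ne, hu⟩) (by omega)
  exact ⟨x, hx, y, Finset.mem_of_mem_erase hy, (Finset.ne_of_mem_erase hy).symm, hux, huy⟩

/-- A nonseparable set with maximum degree two is a cycle. -/
theorem NonsepOn.exists_cycle_index (hS : NonsepOn H S) (h3 : 3 ≤ S.card)
    (hdeg : ∀ v ∈ S, (S.filter (H.Adj v)).card ≤ 2) :
    ∃ g : V → ℕ, Set.InjOn g S ∧ (∀ v ∈ S, g v < S.card) ∧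
      ∀ a ∈ S, ∀ b ∈ S, (H.Adj a b ↔ g a = g b + 1 ∨ g b = g a + 1 ∨
        (g a = 0 ∧ g b + 1 = S.card) ∨ (g b = 0 ∧ g a + 1 = S.card)) := by
  obtain ⟨u, hu⟩ := hS.1
  obtain ⟨x, hx, y, hy, hxy, hux, huy⟩ := hS.exists_two_adj h3 hu
  set T := S.erase u with hT
  have hcard : T.card = S.card - 1 := Finset.card_erase_of_mem hu
  have hmem : ∀ z, z ∈ T ↔ z ∈ S ∧ z ≠ u := fun z => by rw [hT, Finset.mem_erase, and_comm]
  have hsub : ∀ z, T.filter (H.Adj z) ⊆ S.filter (H.Adj z) := fun z =>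
    Finset.filter_subset_filter _ (Finset.erase_subset _ _)
  have hlt : ∀ z ∈ S, H.Adj u z → (T.filter (H.Adj z)).card ≤ 1 := by
    intro z hz huz
    have : (T.filter (H.Adj z)).card < (S.filter (H.Adj z)).card := by
      refine Finset.card_lt_card ⟨hsub z, fun h => ?_⟩
      have := h (Finset.mem_filter.2 ⟨hu, huz.symm⟩)
      simp [hmem] at this
    have := hdeg z hz
    omega
  have hxT : x ∈ T := (hmem x).2 ⟨hx, hux.ne'⟩
  have hyT : y ∈ T := (hmem y).2 ⟨hy, huy.ne'⟩
  obtain ⟨g, hinj, hglt, h0, hadj⟩ := ConnOn.exists_path_index T.card T x rfl (hS.2.2 u hu) hxT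
    (fun z hz => (Finset.card_le_card (hsub z)).trans (hdeg z ((hmem z).1 hz).1))
    (hlt x hx hux)
  have himg : T.image g = Finset.range T.card := by
    refine Finset.eq_of_subset_of_card_le ?_ ?_
    · intro i hi
      obtain ⟨z, hz, rfl⟩ := Finset.mem_image.1 hi
      exact Finset.mem_range.2 (hglt z hz)
    · rw [Finset.card_range, Finset.card_image_of_injOn hinj]
  have hsurj : ∀ i < T.card, ∃ z ∈ T, g z = i := fun i hi => by
    simpa using himg.ge (Finset.mem_range.2 hi)
  -- The other neighbor `y` of `u` has at most one neighbor on the path `T`, so it cannot be an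
  -- interior vertex and must be the far end.
  have hgy : g y + 1 = T.card := by
    by_contra hne
    have hylt := hglt y hyT
    have hy0 : g y ≠ 0 := fun h => hxy (hinj hxT hyT (by rw [h0, h]))
    obtain ⟨p, hp, hpg⟩ := hsurj (g y + 1) (by omega)
    obtain ⟨q, hq, hqg⟩ := hsurj (g y - 1) (by omega)
    have hpq := Finset.card_le_one.1 (hlt y hy huy) p
      (Finset.mem_filter.2 ⟨hp, (hadj y hyT p hp).2 (by omega)⟩) q
      (Finset.mem_filter.2 ⟨hq, (hadj y hyT q hq).2 (by omega)⟩)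
    rw [hpq] at hpg
    omega
  have hu2 : ∀ z ∈ T, (H.Adj u z ↔ z = x ∨ z = y) := by
    intro z hz
    constructor
    · intro huz
      by_contra hcon
      push Not at hcon
      have hss : ({x, y, z} : Finset V) ⊆ S.filter (H.Adj u) := by
        intro p hp
        simp only [Finset.mem_insert, Finset.mem_singleton] at hp
        rcases hp with rfl | rfl | rfl
        · simp [hx, hux]
        · simp [hy, huy]
        · simp [((hmem p).1 hz).1, huz]
      have h1 := Finset.card_le_card hss
      rw [Finset.card_eq_three.2 ⟨x, y, z, hxy, hcon.1.symm, hcon.2.symm, rfl⟩] at h1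
      have := hdeg u hu
      omega
    · rintro (rfl | rfl)
      · exact hux
      · exact huy
  have hu3 : ∀ z ∈ T, (H.Adj u z ↔ g z = 0 ∨ g z + 1 = T.card) := by
    intro z hz
    rw [hu2 z hz]
    constructor
    · rintro (rfl | rfl)
      · exact Or.inl h0
      · exact Or.inr hgy
    · rintro (h | h)
      · exact Or.inl (hinj hz hxT (by rw [h, h0]))
      · exact Or.inr (hinj hz hyT (by omega))
  refine ⟨fun z => if z = u then T.card else g z, ?_, ?_, ?_⟩
  · intro a ha b hb hab
    by_cases hau : a = u <;> by_cases hbu : b = u <;> simp only [hau, hbu, if_true, if_false] at hab ⊢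
    · have := hglt b ((hmem b).2 ⟨hb, hbu⟩)
      omega
    · have := hglt a ((hmem a).2 ⟨ha, hau⟩)
      omega
    · exact hinj ((hmem a).2 ⟨ha, hau⟩) ((hmem b).2 ⟨hb, hbu⟩) hab
  · intro z hz
    by_cases hzu : z = u
    · simp only [hzu, if_true]
      omega
    · have := hglt z ((hmem z).2 ⟨hz, hzu⟩)
      simp only [hzu, if_false]
      omega
  · intro a ha b hb
    by_cases hau : a = u <;> by_cases hbu : b = u
    · simp only [hau, hbu, if_true, SimpleGraph.irrefl, false_iff]
      omega
    · subst hau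
      have := hglt b ((hmem b).2 ⟨hb, hbu⟩)
      simp only [hbu, if_true, if_false, hu3 b ((hmem b).2 ⟨hb, hbu⟩)]
      omega
    · subst hbu
      have := hglt a ((hmem a).2 ⟨ha, hau⟩)
      simp only [hau, if_true, if_false, H.adj_comm a b, hu3 a ((hmem a).2 ⟨ha, hau⟩)]
      omega
    · have h1 := hglt a ((hmem a).2 ⟨ha, hau⟩)
      have h2 := hglt b ((hmem b).2 ⟨hb, hbu⟩)
      simp only [hau, hbu, if_false, hadj a ((hmem a).2 ⟨ha, hau⟩) b ((hmem b).2 ⟨hb, hbu⟩)]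
      omega

/-- The set of vertices reachable from a given one is closed, and a walk starting in a closed set
never leaves it. -/
theorem connOn_iff_preconnected : ConnOn H T ↔ (H.induce (T : Set V)).Preconnected := by
  constructor
  · intro h a b
    have := h (T.filter fun z => ∃ hz : z ∈ T, (H.induce (T : Set V)).Reachable a ⟨z, hz⟩)
      (Finset.filter_subset _ _) (by
        intro p hp q hq hpq
        obtain ⟨hpT, hp1, hp2⟩ := Finset.mem_filter.1 hp
        refine Finset.mem_filter.2 ⟨hq, hq, hp2.trans (SimpleGraph.Adj.reachable ?_)⟩
        exact hpq)
    have hab : b.1 ∈ T.filter fun z => ∃ hz : z ∈ T, (H.induce (T : Set V)).Reachable a ⟨z, hz⟩ := by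
      rcases this with h | h
      · exfalso
        have ha : a.1 ∈ T.filter fun z => ∃ hz : z ∈ T, (H.induce (T : Set V)).Reachable a ⟨z, hz⟩ :=
          Finset.mem_filter.2 ⟨a.2, a.2, SimpleGraph.Reachable.refl _⟩
        rw [h] at ha
        exact Finset.notMem_empty _ ha
      · rw [h]
        exact b.2
    exact (Finset.mem_filter.1 hab).2.2
  · intro h A hA hc
    rcases A.eq_empty_or_nonempty with h0 | ⟨a, ha⟩
    · exact Or.inl h0
    · refine Or.inr (Finset.Subset.antisymm hA fun b hb => ?_)
      obtain ⟨p⟩ := h ⟨a, hA ha⟩ ⟨b, hb⟩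
      have : ∀ (x y : (T : Set V)), (H.induce (T : Set V)).Walk x y → x.1 ∈ A → y.1 ∈ A := by
        intro x y p
        induction p with
        | nil => exact id
        | cons hadj _ ih => exact fun hx => ih (hc _ hx _ (Subtype.mem _) hadj)
      exact this _ _ p ha

end Connectivity

end Multigraph

namespace Multigraph

/-! ### Greedy coloring and the local structure of tight instances. -/

section Coloring

open scoped Classical

variable {V C : Type*} {G : Multigraph V} {R : V → C → V → C → Prop} {L : V → Finset C}
  {S : Finset V} {u v w x y : V}

/-- A symmetric conflict relation between colored vertices, in which a color of `u` conflicts with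
at most `mult u v` colors of `v`. -/
structure IsConflict (G : Multigraph V) (R : V → C → V → C → Prop) : Prop where
  symm : ∀ u c v d, R u c v d → R v d u c
  bound : ∀ u c v (D : Finset C), (D.filter (R u c v)).card ≤ G.mult u v

/-- The degree of `u` into the set `S`. -/
def degOn (G : Multigraph V) (S : Finset V) (u : V) : ℕ := ∑ v ∈ S, G.mult u v

/-- A conflict-free choice of colors for the vertices in `S`. -/
def HasColoring (R : V → C → V → C → Prop) (S : Finset V) (L : V → Finset C) : Prop :=
  ∃ f : V → C, (∀ u ∈ S, f u ∈ L u) ∧ ∀ u ∈ S, ∀ v ∈ S, ¬ R u (f u) v (f v)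

/-- Lists at least as large as the degrees in the sub-multigraph induced by `S`. -/
def IsDegListOn (G : Multigraph V) (S : Finset V) (L : V → Finset C) : Prop :=
  ∀ u ∈ S, G.degOn S u ≤ (L u).card

/-- The colors that remain available after `x` receives the color `c`. -/
noncomputable def avail (R : V → C → V → C → Prop) (x : V) (c : C) (L : V → Finset C) (u : V) :
    Finset C :=
  (L u).filter fun a => ¬ R x c u a

/-- The colors of `v` in conflict with the color `a` of `u`. -/
noncomputable def conf (R : V → C → V → C → Prop) (L : V → Finset C) (u : V) (a : C) (v : V) :
    Finset C :=
  (L v).filter (R u a v)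

theorem IsConflict.not_rel (hR : IsConflict G R) (h : G.mult u v = 0) (c d : C) :
    ¬ R u c v d := by
  intro hr
  have := hR.bound u c v {d}
  rw [Finset.filter_singleton, if_pos hr, h] at this
  simp at this

theorem mem_conf {a b : C} : b ∈ conf R L u a v ↔ b ∈ L v ∧ R u a v b := Finset.mem_filter

theorem mem_avail {a c : C} : a ∈ avail R x c L u ↔ a ∈ L u ∧ ¬ R x c u a := Finset.mem_filter

theorem card_avail_add (x : V) (c : C) (u : V) :
    (avail R x c L u).card + (conf R L x c u).card = (L u).card := by
  rw [add_comm]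
  exact Finset.card_filter_add_card_filter_not _

theorem degOn_erase_add (hx : x ∈ S) (u : V) :
    G.degOn (S.erase x) u + G.mult u x = G.degOn S u :=
  Finset.sum_erase_add S _ hx

theorem toSimpleGraph_adj : G.toSimpleGraph.Adj u v ↔ G.mult u v ≠ 0 := Iff.rfl

/-- Each colored vertex `v` blocks at most `mult u v` colors of `u`, so fewer than `|L u|` colors
are blocked in total. -/
theorem HasColoring.extend (hR : IsConflict G R) (hu : u ∈ S)
    (h : HasColoring R (S.erase u) L) (hlt : G.degOn S u < (L u).card) : HasColoring R S L := by
  obtain ⟨f, hf, hfR⟩ := h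
  obtain ⟨c, hc, hcn⟩ : ∃ c ∈ L u, c ∉ (S.erase u).biUnion fun v => conf R L v (f v) u := by
    by_contra hcon
    push Not at hcon
    have h1 := Finset.card_le_card (show L u ⊆ _ from hcon)
    have h2 : ((S.erase u).biUnion fun v => conf R L v (f v) u).card ≤ G.degOn (S.erase u) u :=
      Finset.card_biUnion_le.trans (Finset.sum_le_sum fun v _ => by
        rw [G.symm u v]
        exact hR.bound v (f v) u _)
    have := G.degOn_erase_add hu u
    omega
  have hcR : ∀ v ∈ S, v ≠ u → ¬ R v (f v) u c := fun v hv hvu hr =>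
    hcn (Finset.mem_biUnion.2 ⟨v, Finset.mem_erase.2 ⟨hvu, hv⟩, mem_conf.2 ⟨hc, hr⟩⟩)
  refine ⟨Function.update f u c, fun v hv => ?_, fun v hv v' hv' => ?_⟩
  · by_cases hvu : v = u
    · subst hvu
      simpa using hc
    · rw [Function.update_of_ne hvu]
      exact hf v (Finset.mem_erase.2 ⟨hvu, hv⟩)
  · by_cases hvu : v = u <;> by_cases hvu' : v' = u
    · rw [hvu, hvu']
      exact hR.not_rel (G.loopless u) _ _
    · rw [hvu, Function.update_self, Function.update_of_ne hvu']
      exact fun hr => hcR v' hv' hvu' (hR.symm _ _ _ _ hr)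
    · rw [hvu', Function.update_self, Function.update_of_ne hvu]
      exact hcR v hv hvu
    · rw [Function.update_of_ne hvu, Function.update_of_ne hvu']
      exact hfR v (Finset.mem_erase.2 ⟨hvu, hv⟩) v' (Finset.mem_erase.2 ⟨hvu', hv'⟩)

/-- Greedy coloring of a set that is degenerate with respect to the list sizes. -/
theorem IsConflict.hasColoring_of_degenerate [Nonempty C] (hR : IsConflict G R) :
    ∀ (k : ℕ) (S : Finset V), S.card = k →
      (∀ A ⊆ S, A.Nonempty → ∃ u ∈ A, G.degOn A u < (L u).card) → HasColoring R S L := by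
  intro k
  induction k with
  | zero =>
    intro S hk _
    rw [Finset.card_eq_zero] at hk
    subst hk
    exact ⟨fun _ => Classical.arbitrary C, by simp, by simp⟩
  | succ k ih =>
    intro S hk h
    obtain ⟨u, hu, hlt⟩ := h S subset_rfl (Finset.card_pos.1 (by omega))
    refine HasColoring.extend hR hu (ih (S.erase u) ?_ fun A hA hne => ?_) hlt
    · rw [Finset.card_erase_of_mem hu, hk, Nat.add_sub_cancel]
    · exact h A (hA.trans (Finset.erase_subset _ _)) hne

/-- A nonempty proper subset `A` of `S` has an edge leaving it, so some vertex has smaller degree in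
`A` than in `S`; for `A = S` the vertex `u` serves. Hence the instance is degenerate. -/
theorem IsConflict.hasColoring_of_surplus (hR : IsConflict G R)
    (hS : ConnOn G.toSimpleGraph S) (hL : G.IsDegListOn S L) (hu : u ∈ S)
    (hlt : G.degOn S u < (L u).card) : HasColoring R S L := by
  have : Nonempty C := by
    obtain ⟨c, -⟩ := Finset.card_pos.1 (Nat.zero_lt_of_lt hlt)
    exact ⟨c⟩
  refine hR.hasColoring_of_degenerate S.card S rfl fun A hA hne => ?_
  by_cases hAS : A = S
  · exact ⟨u, hAS ▸ hu, hAS ▸ hlt⟩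
  · obtain ⟨a, ha, b, hb, hbA, hab⟩ := hS.exists_adj hA hne hAS
    refine ⟨a, ha, lt_of_lt_of_le ?_ (hL a (hA ha))⟩
    exact Finset.sum_lt_sum_of_subset hA hb hbA (Nat.pos_of_ne_zero hab) (fun _ _ _ => Nat.zero_le _)

theorem HasColoring.of_avail (hR : IsConflict G R) {c : C} (hc : c ∈ L x)
    (h : HasColoring R (S.erase x) (avail R x c L)) : HasColoring R S L := by
  obtain ⟨f, hf, hfR⟩ := h
  have hf' : ∀ v ∈ S, v ≠ x → f v ∈ L v ∧ ¬ R x c v (f v) := fun v hv hvx =>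
    mem_avail.1 (hf v (Finset.mem_erase.2 ⟨hvx, hv⟩))
  refine ⟨Function.update f x c, fun v hv => ?_, fun v hv v' hv' => ?_⟩
  · by_cases hvu : v = x
    · subst hvu
      simpa using hc
    · rw [Function.update_of_ne hvu]
      exact (hf' v hv hvu).1
  · by_cases hvu : v = x <;> by_cases hvu' : v' = x
    · rw [hvu, hvu']
      exact hR.not_rel (G.loopless x) _ _
    · rw [hvu, Function.update_self, Function.update_of_ne hvu']
      exact (hf' v' hv' hvu').2
    · rw [hvu', Function.update_self, Function.update_of_ne hvu]
      exact fun hr => (hf' v hv hvu).2 (hR.symm _ _ _ _ hr)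
    · rw [Function.update_of_ne hvu, Function.update_of_ne hvu']
      exact hfR v (Finset.mem_erase.2 ⟨hvu, hv⟩) v' (Finset.mem_erase.2 ⟨hvu', hv'⟩)

/-- Coloring `x` costs `u` at most `mult u x` colors, exactly the amount by which its degree drops.
-/
theorem IsDegListOn.avail (hR : IsConflict G R) (hL : G.IsDegListOn S L) (hx : x ∈ S) (c : C) :
    G.IsDegListOn (S.erase x) (Multigraph.avail R x c L) := by
  intro u hu
  have h1 := hL u (Finset.mem_of_mem_erase hu)
  have h2 := card_avail_add (R := R) (L := L) x c u
  have h3 := G.degOn_erase_add hx u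
  have h4 := hR.bound x c u (L u)
  rw [G.symm x u] at h4
  unfold conf at h2
  omega

/-- A nonseparable set with a degree-list assignment that admits no coloring. -/
structure IsTight (G : Multigraph V) (R : V → C → V → C → Prop) (S : Finset V)
    (L : V → Finset C) : Prop where
  isConflict : IsConflict G R
  nonsep : NonsepOn G.toSimpleGraph S
  isDegListOn : G.IsDegListOn S L
  not_hasColoring : ¬ HasColoring R S L

theorem IsTight.card_eq (h : IsTight G R S L) (hu : u ∈ S) : (L u).card = G.degOn S u := by
  refine le_antisymm (not_lt.1 fun hlt => h.not_hasColoring ?_) (h.isDegListOn u hu)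
  exact h.isConflict.hasColoring_of_surplus h.nonsep.2.1 h.isDegListOn hu hlt

/-- In a tight instance, every color of `u` conflicts with exactly `mult u v` colors of `v`. -/
theorem IsTight.card_conf (h : IsTight G R S L) (hu : u ∈ S) (hv : v ∈ S) {a : C}
    (ha : a ∈ L u) : (conf R L u a v).card = G.mult u v := by
  have hR := h.isConflict
  refine le_antisymm (hR.bound u a v _) (not_lt.1 fun hlt => h.not_hasColoring ?_)
  have hvu : v ≠ u := by
    rintro rfl
    rw [G.loopless] at hlt
    omega
  -- Giving `u` the color `a` would lower the list of `v` by less than its degree, leaving a surplus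
  -- at `v` in the connected set `S - u`.
  refine HasColoring.of_avail hR ha (hR.hasColoring_of_surplus (h.nonsep.2.2 u hu)
    (h.isDegListOn.avail hR hu a) (Finset.mem_erase.2 ⟨hvu, hv⟩) ?_)
  have h1 := h.card_eq hv
  have h2 := card_avail_add (R := R) (L := L) u a v
  have h3 := G.degOn_erase_add hu v
  rw [G.symm v u] at h3
  omega

/-- If removing `x` and `y` does not disconnect, then colors of `x` and `y` in conflict with a
common color of a third vertex are in conflict with each other. -/
theorem IsTight.rel_of_rel (h : IsTight G R S L) (hx : x ∈ S) (hy : y ∈ S) (hv : v ∈ S)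
    (hxy : x ≠ y) (hconn : ConnOn G.toSimpleGraph ((S.erase x).erase y)) {a c d : C}
    (ha : a ∈ L v) (hc : c ∈ L x) (hd : d ∈ L y) (hac : R v a x c) (had : R v a y d) :
    R x c y d := by
  by_contra hcd
  have hR := h.isConflict
  have hne : ∀ z e, R v a z e → v ≠ z := by
    rintro z e hr rfl
    exact hR.not_rel (G.loopless v) _ _ hr
  have hy' : y ∈ S.erase x := Finset.mem_erase.2 ⟨hxy.symm, hy⟩
  refine h.not_hasColoring (HasColoring.of_avail hR hc (HasColoring.of_avail hR (x := y) (c := d)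
    (mem_avail.2 ⟨hd, hcd⟩) (hR.hasColoring_of_surplus hconn
      ((h.isDegListOn.avail hR hx c).avail hR hy' d) (u := v) (by simp [hne _ _ hac, hne _ _ had, hv])
      ?_)))
  have h1 := h.card_eq hv
  have h2 := card_avail_add (R := R) (L := L) x c v
  have h3 := G.degOn_erase_add hx v
  have h4 := h.card_conf hx hv hc
  have h5 := card_avail_add (R := R) (L := avail R x c L) y d v
  have h6 := G.degOn_erase_add hy' v
  have h7 := h.card_conf hy hv hd
  -- The color `a` of `v` is already lost to `c`, so `d` removes strictly fewer colors than the
  -- degree of `v` loses; this is the surplus.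
  have h8 : (conf R (avail R x c L) y d v).card < (conf R L y d v).card := by
    refine Finset.card_lt_card ⟨fun e he => ?_, fun hsub => ?_⟩
    · obtain ⟨he1, he2⟩ := mem_conf.1 he
      exact mem_conf.2 ⟨(mem_avail.1 he1).1, he2⟩
    · have := mem_conf.1 (hsub (mem_conf.2 ⟨ha, hR.symm _ _ _ _ had⟩))
      exact (mem_avail.1 this.1).2 (hR.symm _ _ _ _ hac)
  rw [G.symm v x] at h3
  rw [G.symm v y] at h6
  omega

theorem IsTight.exists_rel (h : IsTight G R S L) (hu : u ∈ S) (hv : v ∈ S)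
    (huv : G.mult u v ≠ 0) {a : C} (ha : a ∈ L u) : ∃ b ∈ L v, R u a v b := by
  have := h.card_conf hu hv ha
  obtain ⟨b, hb⟩ := Finset.card_pos.1 (by omega : 0 < (conf R L u a v).card)
  exact ⟨b, mem_conf.1 hb⟩

theorem IsTight.list_nonempty (h : IsTight G R S L) (hu : u ∈ S) (hv : v ∈ S)
    (huv : G.mult u v ≠ 0) : (L u).Nonempty := by
  rw [← Finset.card_pos, h.card_eq hu]
  exact (Nat.pos_of_ne_zero huv).trans_le
    (Finset.single_le_sum (f := G.mult u) (fun _ _ => Nat.zero_le _) hv)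

/-- The underlying graph of a tight instance is complete or has maximum degree at most two. -/
theorem IsTight.complete_or_degree_le_two (h : IsTight G R S L) :
    (∀ x ∈ S, ∀ y ∈ S, x ≠ y → G.mult x y ≠ 0) ∨
      ∀ v ∈ S, (S.filter (G.toSimpleGraph.Adj v)).card ≤ 2 := by
  by_contra hcon
  push Not at hcon
  obtain ⟨⟨x, hx, y, hy, hxy, hadj⟩, u, hu, hdeg⟩ := hcon
  obtain ⟨v, hv, x, hx, y, hy, hxy, hvx, hvy, hadj, hconn⟩ :=
    h.nonsep.exists_triple hu hdeg hx hy hxy (by simpa [toSimpleGraph_adj] using hadj)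
  obtain ⟨a, ha⟩ := h.list_nonempty hv hx hvx
  obtain ⟨c, hc, hac⟩ := h.exists_rel hv hx hvx ha
  obtain ⟨d, hd, had⟩ := h.exists_rel hv hy hvy ha
  exact h.isConflict.not_rel (by simpa [toSimpleGraph_adj] using hadj) _ _
    (h.rel_of_rel hx hy hv hxy hconn ha hc hd hac had)

/-! ### Multiplicities on complete underlying graphs. -/

section Complete

theorem IsTight.rel_of_complete (h : IsTight G R S L)
    (hcomp : ∀ x ∈ S, ∀ y ∈ S, x ≠ y → G.mult x y ≠ 0)
    (hx : x ∈ S) (hy : y ∈ S) (hv : v ∈ S)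
    (hxy : x ≠ y) {a c d : C} (ha : a ∈ L v) (hc : c ∈ L x) (hd : d ∈ L y)
    (hac : R v a x c) (had : R v a y d) : R x c y d := by
  have hne : ∀ z e, R v a z e → v ≠ z := by
    rintro z e hr rfl
    exact h.isConflict.not_rel (G.loopless v) _ _ hr
  refine h.rel_of_rel hx hy hv hxy ?_ ha hc hd hac had
  refine connOn_of_forall_adj (u := v) (by simp [hne _ _ hac, hne _ _ had, hv]) fun z hz hzv => ?_
  exact hcomp v hv z (Finset.mem_of_mem_erase (Finset.mem_of_mem_erase hz)) hzv.symm

/-- For conflicting colors `a` of `v` and `c` of `x`, every color of `y` in conflict with `a` also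
conflicts with `c`. There are exactly `mult v y` of the former and at most `mult x y` of the latter.
-/
theorem IsTight.mult_le_of_complete (h : IsTight G R S L)
    (hcomp : ∀ x ∈ S, ∀ y ∈ S, x ≠ y → G.mult x y ≠ 0)
    (hx : x ∈ S) (hy : y ∈ S) (hv : v ∈ S)
    (hxy : x ≠ y) (hvx : v ≠ x) : G.mult v y ≤ G.mult x y := by
  obtain ⟨a, ha⟩ := h.list_nonempty hv hx (hcomp v hv x hx hvx)
  obtain ⟨c, hc, hac⟩ := h.exists_rel hv hx (hcomp v hv x hx hvx) ha
  rw [← h.card_conf hv hy ha]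
  refine le_trans (Finset.card_le_card fun d hd => ?_) (h.isConflict.bound x c y (L y))
  obtain ⟨hd, had⟩ := mem_conf.1 hd
  exact mem_conf.2 ⟨hd, h.rel_of_complete hcomp hx hy hv hxy ha hc hd hac had⟩

theorem IsTight.exists_mult_of_complete (h : IsTight G R S L)
    (hcomp : ∀ x ∈ S, ∀ y ∈ S, x ≠ y → G.mult x y ≠ 0) :
    ∃ t, 1 ≤ t ∧ ∀ x ∈ S, ∀ y ∈ S, x ≠ y → G.mult x y = t := by
  have hle : ∀ x ∈ S, ∀ y ∈ S, ∀ v ∈ S, x ≠ y → v ≠ y → G.mult v y = G.mult x y := by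
    intro x hx y hy v hv hxy hvy
    by_cases hvx : v = x
    · rw [hvx]
    · exact le_antisymm (h.mult_le_of_complete hcomp hx hy hv hxy hvx)
        (h.mult_le_of_complete hcomp hv hy hx hvy (Ne.symm hvx))
  by_cases hex : ∃ p ∈ S, ∃ q ∈ S, p ≠ q
  · obtain ⟨p, hp, q, hq, hpq⟩ := hex
    refine ⟨G.mult p q, Nat.pos_of_ne_zero (hcomp p hp q hq hpq), fun x hx y hy hxy => ?_⟩
    by_cases hyp : y = p
    · subst hyp
      rw [hle q hq y hy x hx hpq.symm hxy, G.symm]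
    · rw [hle p hp y hy x hx (Ne.symm hyp) hxy, G.symm p y, G.symm p q]
      by_cases hyq : y = q
      · rw [hyq]
      · exact hle q hq p hp y hy hpq.symm hyp
  · push Not at hex
    -- A single vertex has no edges, so any positive multiplicity serves.
    exact ⟨1, le_rfl, fun x hx y hy hxy => absurd (hex x hx y hy) hxy⟩

end Complete

/-! ### Vertices of degree two: splitting a list into halves. -/

section DegreeTwo

/-- Coloring one neighbor `w` of a vertex `u` of degree two leaves a complete bipartite conflict
graph between the remaining colors of `u` and a set of colors of its other neighbor `v`. -/
theorem IsTight.exists_biclique (h : IsTight G R S L) (hw : w ∈ S) (hu : u ∈ S) (hv : v ∈ S)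
    (hwv : w ≠ v) (huw : G.mult u w ≠ 0) (huv : G.mult u v ≠ 0) (hwv0 : G.mult w v = 0)
    (hdeg : ∀ z ∈ S, G.mult u z ≠ 0 → z = w ∨ z = v) {c : C} (hc : c ∈ L w) :
    ∃ T, T.Nonempty ∧ T ⊆ L v ∧ (∀ a ∈ L u, ¬ R w c u a → conf R L u a v = T) ∧
      ∀ b ∈ T, conf R L v b u = L u \ conf R L w c u := by
  have hR := h.isConflict
  have huw' : u ≠ w := by
    rintro rfl
    exact huw (G.loopless u)
  have huv' : u ≠ v := by
    rintro rfl
    exact huv (G.loopless u)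
  set D := avail R w c L u with hD
  have hDeq : D = L u \ conf R L w c u := by
    ext a
    simp only [hD, mem_avail, Finset.mem_sdiff, mem_conf]
    tauto
  have hdu : G.degOn S u = G.mult u w + G.mult u v := by
    rw [degOn, ← Finset.sum_pair hwv]
    symm
    refine Finset.sum_subset (by simp [Finset.insert_subset_iff, hw, hv]) fun z hz hz' => ?_
    by_contra hne
    simpa using hz' (by simpa using hdeg z hz hne)
  have hDcard : D.card = G.mult u v := by
    have h1 := card_avail_add (R := R) (L := L) w c u
    rw [h.card_conf hw hu hc, h.card_eq hu, hdu, G.symm w u, ← hD] at h1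
    omega
  -- Once `w` has color `c`, the vertex `u` hangs on `v` alone, with remaining colors `D`. A color
  -- of `v` leaves no choice at `u` exactly when it conflicts with all of `D`.
  set T := (L v).filter fun b => ∀ a ∈ D, R v b u a with hT
  have hTu : ∀ a ∈ D, T ⊆ conf R L u a v := fun a ha b hb =>
    mem_conf.2 ⟨(Finset.mem_filter.1 hb).1, hR.symm _ _ _ _ ((Finset.mem_filter.1 hb).2 a ha)⟩
  set S₂ := (S.erase w).erase u with hS₂
  have hu1 : u ∈ S.erase w := Finset.mem_erase.2 ⟨huw', hu⟩
  have hv1 : v ∈ S.erase w := Finset.mem_erase.2 ⟨hwv.symm, hv⟩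
  have hv2 : v ∈ S₂ := Finset.mem_erase.2 ⟨huv'.symm, hv1⟩
  have hzero : ∀ z ∈ S₂, z ≠ v → G.mult u z = 0 := by
    intro z hz hzv
    by_contra hne
    simp only [hS₂, Finset.mem_erase] at hz
    rcases hdeg z hz.2.2 hne with h | h
    · exact hz.2.1 h
    · exact hzv h
  have hconn : ConnOn G.toSimpleGraph S₂ := by
    refine (h.nonsep.2.2 w hw).erase_leaf hv1 huv'.symm fun z hz huz => ?_
    rcases hdeg z (Finset.mem_of_mem_erase hz) huz with h | h
    · exact absurd h (Finset.ne_of_mem_erase hz)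
    · exact h
  -- Deleting `T` from the list of `v` guarantees a free color at `u`, so a coloring of the rest
  -- from these lists would extend.
  set L₂ : V → Finset C := fun z =>
    (avail R w c L z).filter fun b => z = v → ∃ a ∈ D, ¬ R v b u a with hL₂
  have hL₂sub : ∀ z, L₂ z ⊆ avail R w c L z := fun z => Finset.filter_subset _ _
  have hncol : ¬ HasColoring R S₂ L₂ := by
    rintro ⟨f, hf, hfR⟩
    obtain ⟨a, ha, har⟩ := (Finset.mem_filter.1 (hf v hv2)).2 rfl
    refine h.not_hasColoring (HasColoring.of_avail hR hc (HasColoring.of_avail hR ha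
      ⟨f, fun z hz => mem_avail.2 ⟨hL₂sub z (hf z hz), fun hr => ?_⟩, hfR⟩))
    by_cases hzv : z = v
    · subst hzv
      exact har (hR.symm _ _ _ _ hr)
    · exact hR.not_rel (hzero z hz hzv) _ _ hr
  have hL₂v : (L₂ v).card + T.card = (L v).card := by
    have : L₂ v = (L v).filter fun b => ¬ ∀ a ∈ D, R v b u a := by
      ext b
      simp only [hL₂, Finset.mem_filter, mem_avail, forall_const]
      push Not
      exact and_congr_left fun _ => and_iff_left (hR.not_rel hwv0 _ _)
    rw [this, add_comm]
    exact Finset.card_filter_add_card_filter_not _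
  have hd2 := G.degOn_erase_add hu1 v
  have hd1 := G.degOn_erase_add hw v
  rw [G.symm v w, hwv0] at hd1
  rw [← hS₂] at hd2
  -- If `T` had fewer than `mult u v` colors, `v` would lose less from its list than from its degree
  -- when `u` is removed, and the surplus would color the rest.
  have hTcard : G.mult u v ≤ T.card := by
    by_contra hlt
    have hsur : G.degOn S₂ v < (L₂ v).card := by
      have := h.card_eq hv
      have := G.symm u v
      omega
    refine hncol (hR.hasColoring_of_surplus hconn (fun z hz => ?_) hv2 hsur)
    by_cases hzv : z = v
    · rw [hzv]
      exact hsur.le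
    · have : L₂ z = avail R w c L z := by
        refine Finset.filter_true_of_mem fun b _ hz => absurd hz hzv
      rw [this]
      have h1 := h.isDegListOn.avail hR hw c z (Finset.mem_of_mem_erase hz)
      have h2 := G.degOn_erase_add hu1 z
      rw [← hS₂] at h2
      omega
  refine ⟨T, Finset.card_pos.1 (by omega), Finset.filter_subset _ _, fun a ha hwa => ?_,
    fun b hb => ?_⟩
  · exact (Finset.eq_of_subset_of_card_le (hTu a (mem_avail.2 ⟨ha, hwa⟩))
      (by rw [h.card_conf hu hv ha]; exact hTcard)).symm
  · rw [← hDeq]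
    obtain ⟨hbv, hbD⟩ := Finset.mem_filter.1 hb
    refine (Finset.eq_of_subset_of_card_le (fun a ha =>
      mem_conf.2 ⟨(mem_avail.1 ha).1, hbD a ha⟩) ?_).symm
    rw [h.card_conf hv hu hbv, hDcard, G.symm]

/-- At a vertex of degree two with nonadjacent neighbors, both multiplicities agree, and the list
splits into two halves such that each color of a neighbor conflicts with exactly one half. -/
theorem IsTight.exists_halves (h : IsTight G R S L) (hw : w ∈ S) (hu : u ∈ S) (hv : v ∈ S)
    (hwv : w ≠ v) (huw : G.mult u w ≠ 0) (huv : G.mult u v ≠ 0) (hwv0 : G.mult w v = 0)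
    (hdeg : ∀ z ∈ S, G.mult u z ≠ 0 → z = w ∨ z = v) :
    G.mult u w = G.mult u v ∧ ∃ A ⊆ L u, A.card = G.mult u w ∧ (L u \ A).card = G.mult u w ∧
      (∀ c ∈ L w, conf R L w c u = A ∨ conf R L w c u = L u \ A) ∧
      ∀ c ∈ L v, conf R L v c u = A ∨ conf R L v c u = L u \ A := by
  have hR := h.isConflict
  have key1 := fun (c : C) (hc : c ∈ L w) =>
    h.exists_biclique hw hu hv hwv huw huv hwv0 hdeg hc
  have key2 := fun (b : C) (hb : b ∈ L v) =>
    h.exists_biclique hv hu hw hwv.symm huv huw (by rw [G.symm, hwv0])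
      (fun z hz hne => (hdeg z hz hne).symm) hb
  have cw : ∀ c ∈ L w, (conf R L w c u).card = G.mult u w := fun c hc => by
    rw [h.card_conf hw hu hc, G.symm]
  have cv : ∀ c ∈ L v, (conf R L v c u).card = G.mult u v := fun c hc => by
    rw [h.card_conf hv hu hc, G.symm]
  obtain ⟨c₀, hc₀⟩ := h.list_nonempty hw hu (by rwa [G.symm])
  -- One half is the conflict set of an arbitrary color of `w`. The biclique for `c₀` supplies a
  -- color `b₀` of `v` whose conflict set is the complementary half.
  set A := conf R L w c₀ u with hA
  have hAL : A ⊆ L u := Finset.filter_subset _ _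
  obtain ⟨T, ⟨b₀, hb₀⟩, hTv, hT, hTD⟩ := key1 c₀ hc₀
  have hb₀v := hTv hb₀
  have hb₀D : conf R L v b₀ u = L u \ A := hTD b₀ hb₀
  obtain ⟨T', -, -, hT', -⟩ := key2 b₀ hb₀v
  have memD : ∀ a ∈ L u, a ∉ A → conf R L u a v = T := fun a ha haA =>
    hT a ha fun hr => haA (mem_conf.2 ⟨ha, hr⟩)
  have memA : ∀ a ∈ A, conf R L u a w = T' := fun a ha =>
    hT' a (hAL ha) fun hr => by
      have : a ∈ conf R L v b₀ u := mem_conf.2 ⟨hAL ha, hr⟩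
      rw [hb₀D] at this
      exact (Finset.mem_sdiff.1 this).2 ha
  have hDcard : (L u \ A).card = G.mult u v := by rw [← hb₀D, cv b₀ hb₀v]
  have hAcard : A.card = G.mult u w := cw c₀ hc₀
  -- All colors in `A` have the same conflict set `T'` at `w`, so a color of `w` that conflicts with
  -- one of them conflicts with all, and the cardinalities agree.
  have wA : ∀ c ∈ L w, ∀ a ∈ A, R w c u a → conf R L w c u = A := by
    intro c hc a ha hr
    refine (Finset.eq_of_subset_of_card_le (fun a' ha' => mem_conf.2 ⟨hAL ha', ?_⟩) ?_).symm
    · have : c ∈ conf R L u a w := mem_conf.2 ⟨hc, hR.symm _ _ _ _ hr⟩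
      rw [memA a ha, ← memA a' ha'] at this
      exact hR.symm _ _ _ _ (mem_conf.1 this).2
    · rw [cw c hc, hAcard]
  have vD : ∀ b ∈ L v, ∀ a ∈ L u \ A, R v b u a → conf R L v b u = L u \ A := by
    intro b hb a ha hr
    refine (Finset.eq_of_subset_of_card_le (fun a' ha' => ?_) ?_).symm
    · rw [Finset.mem_sdiff] at ha ha'
      refine mem_conf.2 ⟨ha'.1, ?_⟩
      have : b ∈ conf R L u a v := mem_conf.2 ⟨hb, hR.symm _ _ _ _ hr⟩
      rw [memD a ha.1 ha.2, ← memD a' ha'.1 ha'.2] at this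
      exact hR.symm _ _ _ _ (mem_conf.1 this).2
    · rw [cv b hb, hDcard]
  have wD : ∀ c ∈ L w, conf R L w c u ≠ A → conf R L w c u ⊆ L u \ A := by
    intro c hc hne a ha
    obtain ⟨ha, hr⟩ := mem_conf.1 ha
    exact Finset.mem_sdiff.2 ⟨ha, fun haA => hne (wA c hc a haA hr)⟩
  have vA : ∀ b ∈ L v, conf R L v b u ≠ L u \ A → conf R L v b u ⊆ A := by
    intro b hb hne a ha
    obtain ⟨ha, hr⟩ := mem_conf.1 ha
    by_contra haA
    exact hne (vD b hb a (Finset.mem_sdiff.2 ⟨ha, haA⟩) hr)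
  -- A color outside `A` conflicts with some color of `w`, whose conflict set is not `A` and
  -- therefore fits into the complement.
  have hle1 : G.mult u w ≤ G.mult u v := by
    obtain ⟨a, ha⟩ := Finset.card_pos.1 (by omega : 0 < (L u \ A).card)
    rw [Finset.mem_sdiff] at ha
    obtain ⟨c, hc, hac⟩ := h.exists_rel hu hw huw ha.1
    rw [← cw c hc, ← hDcard]
    refine Finset.card_le_card (wD c hc fun heq => ha.2 ?_)
    rw [← heq]
    exact mem_conf.2 ⟨ha.1, hR.symm _ _ _ _ hac⟩
  have hle2 : G.mult u v ≤ G.mult u w := by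
    obtain ⟨a, ha⟩ := Finset.card_pos.1 (by omega : 0 < A.card)
    obtain ⟨b, hb, hab⟩ := h.exists_rel hu hv huv (hAL ha)
    rw [← cv b hb, ← hAcard]
    refine Finset.card_le_card (vA b hb fun heq => ?_)
    have : a ∈ L u \ A := by
      rw [← heq]
      exact mem_conf.2 ⟨hAL ha, hR.symm _ _ _ _ hab⟩
    exact (Finset.mem_sdiff.1 this).2 ha
  have heq := le_antisymm hle1 hle2
  refine ⟨heq, A, hAL, hAcard, by rw [hDcard, heq], fun c hc => ?_, fun b hb => ?_⟩
  · by_cases hne : conf R L w c u = A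
    · exact Or.inl hne
    · exact Or.inr (Finset.eq_of_subset_of_card_le (wD c hc hne) (by rw [hDcard, cw c hc, heq]))
  · by_cases hne : conf R L v b u = L u \ A
    · exact Or.inr hne
    · exact Or.inl (Finset.eq_of_subset_of_card_le (vA b hb hne) (by rw [hAcard, cv b hb, heq]))

end DegreeTwo

end Coloring

end Multigraph

namespace Multigraph

/-! ### Block decomposition at cut vertices. -/

section Blocks

open scoped Classical

variable {V C : Type*} {G : Multigraph V} {H : SimpleGraph V} {R : V → C → V → C → Prop}
  {L : V → Finset C} {S S₁ S₂ T A B : Finset V} {u v w z : V}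

/-- `B` is a maximal nonseparable subset of `S`. -/
def BlockOf (H : SimpleGraph V) (S B : Finset V) : Prop :=
  Maximal (fun B => B ⊆ S ∧ NonsepOn H B) B

theorem BlockOf.subset (h : BlockOf H S B) : B ⊆ S := h.prop.1

theorem BlockOf.nonsep (h : BlockOf H S B) : NonsepOn H B := h.prop.2

theorem NonsepOn.blockOf_self_iff (h : NonsepOn H S) : BlockOf H S B ↔ B = S := by
  constructor
  · intro hB
    exact hB.eq_of_le ⟨subset_rfl, h⟩ hB.subset
  · rintro rfl
    exact ⟨⟨subset_rfl, h⟩, fun B' hB' _ => hB'.1⟩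

theorem nonsepOn_pair (h : H.Adj v w) : NonsepOn H {v, w} := by
  refine ⟨by simp, connOn_of_forall_adj (u := v) (by simp) fun z hz hzv => ?_, fun z hz => ?_⟩
  · simp only [Finset.mem_insert, Finset.mem_singleton] at hz
    rcases hz with rfl | rfl
    · exact absurd rfl hzv
    · exact h
  · refine connOn_of_card_le_one ?_
    rw [Finset.card_erase_of_mem hz, Finset.card_pair h.ne]

/-- An edge at `v` is a nonseparable pair, so `{v}` is not maximal. This prevents a block from lying
in both sides of a split. -/
theorem BlockOf.not_subset_singleton (hB : BlockOf H T B) (hT : ConnOn H T) (h2 : 2 ≤ T.card)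
    (hv : v ∈ T) : ¬ B ⊆ {v} := by
  intro hBv
  obtain ⟨w, hw, hvw⟩ := hT.exists_adj_of_mem hv h2
  have := hB.eq_of_le (y := {v, w})
    ⟨by simp [Finset.insert_subset_iff, hv, hw], nonsepOn_pair hvw⟩
    (hBv.trans (by simp))
  have hwB : w ∈ B := by simp [this]
  exact hvw.ne' (Finset.mem_singleton.1 (hBv hwB))

/-- `v` is a cut vertex of `S`, separating it into `S₁` and `S₂`. -/
structure IsSplit (H : SimpleGraph V) (S : Finset V) (v : V) (S₁ S₂ : Finset V) : Prop where
  union_eq : S₁ ∪ S₂ = S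
  inter_eq : S₁ ∩ S₂ = {v}
  conn_left : ConnOn H S₁
  conn_right : ConnOn H S₂
  two_le_left : 2 ≤ S₁.card
  two_le_right : 2 ≤ S₂.card
  not_adj : ∀ a ∈ S₁, a ≠ v → ∀ b ∈ S₂, b ≠ v → ¬ H.Adj a b

namespace IsSplit

theorem swap (h : IsSplit H S v S₁ S₂) : IsSplit H S v S₂ S₁ where
  union_eq := by rw [Finset.union_comm, h.union_eq]
  inter_eq := by rw [Finset.inter_comm, h.inter_eq]
  conn_left := h.conn_right
  conn_right := h.conn_left
  two_le_left := h.two_le_right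
  two_le_right := h.two_le_left
  not_adj a ha hav b hb hbv hab := h.not_adj b hb hbv a ha hav hab.symm

theorem subset_left (h : IsSplit H S v S₁ S₂) : S₁ ⊆ S := h.union_eq ▸ Finset.subset_union_left

theorem mem_left (h : IsSplit H S v S₁ S₂) : v ∈ S₁ :=
  Finset.mem_of_mem_inter_left (h.inter_eq.ge (Finset.mem_singleton_self v))

theorem eq_of_mem (h : IsSplit H S v S₁ S₂) (h₁ : u ∈ S₁) (h₂ : u ∈ S₂) : u = v :=
  Finset.mem_singleton.1 (h.inter_eq.le (Finset.mem_inter.2 ⟨h₁, h₂⟩))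

theorem mem_or_mem (h : IsSplit H S v S₁ S₂) (hu : u ∈ S) : u ∈ S₁ ∨ u ∈ S₂ :=
  Finset.mem_union.1 (h.union_eq.ge hu)

theorem card_left_lt (h : IsSplit H S v S₁ S₂) : S₁.card < S.card := by
  have h1 := Finset.card_union_add_card_inter S₁ S₂
  rw [h.union_eq, h.inter_eq, Finset.card_singleton] at h1
  have := h.two_le_right
  omega

/-- `B - v` is connected and no edge joins the two sides away from `v`. -/
theorem subset_or_subset (h : IsSplit H S v S₁ S₂) (hBS : B ⊆ S) (hB : NonsepOn H B) :
    B ⊆ S₁ ∨ B ⊆ S₂ := by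
  have hconn : ConnOn H (B.erase v) := by
    by_cases hv : v ∈ B
    · exact hB.2.2 v hv
    · rw [Finset.erase_eq_of_notMem hv]
      exact hB.2.1
  rcases hconn (B.erase v ∩ S₁) Finset.inter_subset_left (by
    intro a ha b hb hab
    rw [Finset.mem_inter, Finset.mem_erase] at ha
    rw [Finset.mem_erase] at hb
    refine Finset.mem_inter.2 ⟨Finset.mem_erase.2 hb, ?_⟩
    rcases h.mem_or_mem (hBS hb.2) with hb' | hb'
    · exact hb'
    · exact absurd hab (h.not_adj a ha.2 ha.1.1 b hb' hb.1)) with h0 | h0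
  · right
    intro b hb
    by_cases hbv : b = v
    · exact hbv ▸ h.swap.mem_left
    · refine (h.mem_or_mem (hBS hb)).resolve_left fun hb' => ?_
      exact Finset.notMem_empty b
        (h0 ▸ Finset.mem_inter.2 ⟨Finset.mem_erase.2 ⟨hbv, hb⟩, hb'⟩)
  · left
    intro b hb
    by_cases hbv : b = v
    · exact hbv ▸ h.mem_left
    · exact Finset.mem_of_mem_inter_right (h0.ge (Finset.mem_erase.2 ⟨hbv, hb⟩))

theorem blockOf_left (h : IsSplit H S v S₁ S₂) (hB : BlockOf H S₁ B) : BlockOf H S B := by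
  refine ⟨⟨hB.subset.trans h.subset_left, hB.nonsep⟩, fun B' hB' hle => ?_⟩
  rcases h.subset_or_subset hB'.1 hB'.2 with h' | h'
  · exact hB.le_of_ge ⟨h', hB'.2⟩ hle
  · exfalso
    refine hB.not_subset_singleton h.conn_left h.two_le_left h.mem_left fun b hb => ?_
    exact Finset.mem_singleton.2 (h.eq_of_mem (hB.subset hb) (h' (hle hb)))

theorem blockOf_iff (h : IsSplit H S v S₁ S₂) :
    BlockOf H S B ↔ BlockOf H S₁ B ∨ BlockOf H S₂ B := by
  constructor
  · intro hB
    rcases h.subset_or_subset hB.subset hB.nonsep with h' | h'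
    · exact Or.inl ⟨⟨h', hB.nonsep⟩, fun B' hB' hle =>
        hB.le_of_ge ⟨hB'.1.trans h.subset_left, hB'.2⟩ hle⟩
    · exact Or.inr ⟨⟨h', hB.nonsep⟩, fun B' hB' hle =>
        hB.le_of_ge ⟨hB'.1.trans h.swap.subset_left, hB'.2⟩ hle⟩
  · rintro (hB | hB)
    · exact h.blockOf_left hB
    · exact h.swap.blockOf_left hB

theorem not_blockOf_right (h : IsSplit H S v S₁ S₂) (hB : BlockOf H S₁ B) : ¬ BlockOf H S₂ B :=
  fun hB' => hB.not_subset_singleton h.conn_left h.two_le_left h.mem_left fun _ hb =>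
    Finset.mem_singleton.2 (h.eq_of_mem (hB.subset hb) (hB'.subset hb))

theorem degOn_left (h : IsSplit G.toSimpleGraph S v S₁ S₂) (hz : z ∈ S₁) (hzv : z ≠ v) :
    G.degOn S₁ z = G.degOn S z := by
  refine Finset.sum_subset h.subset_left fun b hb hb₁ => ?_
  have hb₂ := (h.mem_or_mem hb).resolve_left hb₁
  have hbv : b ≠ v := fun e => hb₁ (e ▸ h.mem_left)
  exact not_not.1 (h.not_adj z hz hzv b hb₂ hbv)

theorem degOn_add (h : IsSplit G.toSimpleGraph S v S₁ S₂) :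
    G.degOn S₁ v + G.degOn S₂ v = G.degOn S v := by
  have := Finset.sum_union_inter (s₁ := S₁) (s₂ := S₂) (f := G.mult v)
  rw [h.union_eq, h.inter_eq, Finset.sum_singleton, G.loopless, add_zero] at this
  exact this.symm

end IsSplit

theorem ConnOn.insert_closed (hS : ConnOn H S) (hv : v ∈ S) (hA : A ⊆ S.erase v)
    (hc : ClosedIn H (S.erase v) A) : ConnOn H (insert v A) := by
  rw [connOn_iff_of_mem (Finset.mem_insert_self v A)]
  intro A' hA' hc' hv'
  refine (connOn_iff_of_mem hv).1 hS A' (hA'.trans (Finset.insert_subset hv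
    (hA.trans (Finset.erase_subset _ _)))) (fun a ha b hb hab => ?_) hv'
  refine hc' a ha b (Finset.mem_insert.2 ?_) hab
  by_cases hbv : b = v
  · exact Or.inl hbv
  · refine Or.inr (hc a ?_ b (Finset.mem_erase.2 ⟨hbv, hb⟩) hab)
    exact (Finset.mem_insert.1 (hA' ha)).resolve_left fun e => hv' (e ▸ ha)

/-- A nontrivial closed part of `S - v` and its complement, each with the cut vertex `v` put back,
form the two sides. -/
theorem ConnOn.exists_split (hS : ConnOn H S) (hne : S.Nonempty) (hns : ¬ NonsepOn H S) :
    ∃ v S₁ S₂, IsSplit H S v S₁ S₂ := by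
  obtain ⟨v, hv, hsep⟩ : ∃ v ∈ S, ¬ ConnOn H (S.erase v) := by
    by_contra hcon
    push Not at hcon
    exact hns ⟨hne, hS, hcon⟩
  unfold ConnOn at hsep
  push Not at hsep
  obtain ⟨A, hA, hc, hA0, hA1⟩ := hsep
  have hvA : v ∉ A := fun h => Finset.notMem_erase v S (hA h)
  have hne' : (S.erase v \ A).Nonempty := by
    rw [Finset.nonempty_iff_ne_empty]
    intro h
    exact hA1 (Finset.Subset.antisymm hA (Finset.sdiff_eq_empty_iff_subset.1 h))
  have hv' : v ∉ S.erase v \ A := by simp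
  refine ⟨v, insert v A, insert v (S.erase v \ A), ?_, ?_, hS.insert_closed hv hA hc,
    hS.insert_closed hv Finset.sdiff_subset hc.sdiff, ?_, ?_, ?_⟩
  · rw [← Finset.insert_union_distrib, Finset.union_sdiff_of_subset hA, Finset.insert_erase hv]
  · rw [← Finset.insert_inter_distrib, Finset.inter_sdiff_self, insert_empty_eq]
  · rw [Finset.card_insert_of_notMem hvA]
    have := hA0.card_pos
    omega
  · rw [Finset.card_insert_of_notMem hv']
    have := hne'.card_pos
    omega
  · intro a ha hav b hb hbv hab
    have ha' := (Finset.mem_insert.1 ha).resolve_left hav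
    have hb' := Finset.mem_sdiff.1 ((Finset.mem_insert.1 hb).resolve_left hbv)
    exact hb'.2 (hc a ha' b hb'.1 hab)

/-- If every vertex of a connected set is assigned to some block containing it, then some block
is assigned to all its vertices. -/
theorem ConnOn.exists_full_block (P : V → Finset V → Prop) :
    ∀ (k : ℕ) (S : Finset V), S.card ≤ k → S.Nonempty → ConnOn H S →
      (∀ u ∈ S, ∃ B, BlockOf H S B ∧ u ∈ B ∧ P u B) → ∃ B, BlockOf H S B ∧ ∀ u ∈ B, P u B := by
  intro k
  induction k with
  | zero =>
    intro S hk hne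
    exact absurd hne.card_pos (by omega)
  | succ k ih =>
    intro S hk hne hS h
    by_cases hns : NonsepOn H S
    · refine ⟨S, hns.blockOf_self_iff.2 rfl, fun u hu => ?_⟩
      obtain ⟨B, hB, -, hP⟩ := h u hu
      rwa [hns.blockOf_self_iff.1 hB] at hP
    obtain ⟨v, S₁, S₂, hsplit⟩ := hS.exists_split hne hns
    -- The induction enters the side containing the block assigned to `v`. Any other vertex of that
    -- side lies only in blocks of that side, so its assigned block is kept.
    have main : ∀ S₁ S₂, IsSplit H S v S₁ S₂ → (∃ B, BlockOf H S₁ B ∧ v ∈ B ∧ P v B) →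
        ∃ B, BlockOf H S B ∧ ∀ u ∈ B, P u B := by
      intro S₁ S₂ hsp hv
      have := hsp.card_left_lt
      obtain ⟨B, hB, hBP⟩ := ih S₁ (by omega) ⟨v, hsp.mem_left⟩ hsp.conn_left (by
        intro u hu
        by_cases huv : u = v
        · exact huv ▸ hv
        · obtain ⟨B, hB, huB, hP⟩ := h u (hsp.subset_left hu)
          refine ⟨B, (hsp.blockOf_iff.1 hB).resolve_right fun hB' => huv ?_, huB, hP⟩
          exact hsp.eq_of_mem hu (hB'.subset huB))
      exact ⟨B, hsp.blockOf_left hB, hBP⟩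
    obtain ⟨B, hB, hvB, hP⟩ := h v (hsplit.subset_left hsplit.mem_left)
    rcases hsplit.blockOf_iff.1 hB with hB | hB
    · exact main _ _ hsplit ⟨B, hB, hvB, hP⟩
    · exact main _ _ hsplit.swap ⟨B, hB, hvB, hP⟩

/-- The colors of `v` that do not extend to a coloring of `S`. -/
noncomputable def badColors (R : V → C → V → C → Prop) (S : Finset V) (v : V)
    (L : V → Finset C) : Finset C :=
  (L v).filter fun a => ¬ HasColoring R S (Function.update L v {a})

theorem not_hasColoring_badColors (hv : v ∈ S) :
    ¬ HasColoring R S (Function.update L v (badColors R S v L)) := by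
  rintro ⟨f, hf, hfR⟩
  have h := hf v hv
  rw [Function.update_self] at h
  refine (Finset.mem_filter.1 h).2 ⟨f, fun u hu => ?_, hfR⟩
  by_cases huv : u = v
  · subst huv
    simp
  · have := hf u hu
    rwa [Function.update_of_ne huv] at this ⊢

namespace IsSplit

theorem isDegListOn_update (h : IsSplit G.toSimpleGraph S v S₁ S₂) (hL : G.IsDegListOn S L)
    {D : Finset C} (hD : G.degOn S₁ v ≤ D.card) :
    G.IsDegListOn S₁ (Function.update L v D) := by
  intro z hz
  by_cases hzv : z = v
  · subst hzv
    simpa using hD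
  · rw [Function.update_of_ne hzv, h.degOn_left hz hzv]
    exact hL z (h.subset_left hz)

/-- With more bad colors than its degree into `S₁`, the vertex `v` would have a surplus, and `S₁`
could be colored with a bad color at `v`. -/
theorem card_badColors_le (h : IsSplit G.toSimpleGraph S v S₁ S₂) (hR : IsConflict G R)
    (hL : G.IsDegListOn S L) : (badColors R S₁ v L).card ≤ G.degOn S₁ v := by
  by_contra hlt
  push Not at hlt
  refine not_hasColoring_badColors h.mem_left
    (hR.hasColoring_of_surplus h.conn_left (h.isDegListOn_update hL hlt.le) h.mem_left ?_)
  rwa [Function.update_self]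

/-- If a color of `v` extends to both sides, the two colorings agree at `v` and glue, since no edge
joins the sides elsewhere. -/
theorem badColors_union (h : IsSplit G.toSimpleGraph S v S₁ S₂) (hR : IsConflict G R)
    (hcol : ¬ HasColoring R S L) : badColors R S₁ v L ∪ badColors R S₂ v L = L v := by
  refine Finset.Subset.antisymm
    (Finset.union_subset (Finset.filter_subset _ _) (Finset.filter_subset _ _)) fun a ha => ?_
  by_contra hcon
  simp only [badColors, Finset.mem_union, Finset.mem_filter, ha, true_and, not_or, not_not] at hcon
  obtain ⟨⟨f, hf, hfR⟩, g, hg, hgR⟩ := hcon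
  have hfv : f v = a := by simpa using hf v h.mem_left
  have hgv : g v = a := by simpa using hg v h.swap.mem_left
  set F : V → C := fun u => if u ∈ S₁ then f u else g u with hF
  have hF₁ : ∀ u ∈ S₁, F u = f u := fun u hu => if_pos hu
  have hF₂ : ∀ u ∈ S₂, F u = g u := by
    intro u hu
    by_cases hu₁ : u ∈ S₁
    · rw [hF₁ u hu₁, h.eq_of_mem hu₁ hu, hfv, hgv]
    · exact if_neg hu₁
  have hlist : ∀ (e : V → C) (T : Finset V),
      (∀ u ∈ T, e u ∈ (Function.update L v {a} : V → Finset C) u) → ∀ u ∈ T, e u ∈ L u := by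
    intro e T he u hu
    have := he u hu
    by_cases huv : u = v
    · subst huv
      rw [Function.update_self, Finset.mem_singleton] at this
      rwa [this]
    · rwa [Function.update_of_ne huv] at this
  have hmix : ∀ u ∈ S₁, ∀ u' ∈ S₂, ¬ R u (F u) u' (F u') := by
    intro u hu u' hu'
    by_cases huv : u = v
    · rw [hF₂ u' hu', hF₂ u (huv ▸ h.swap.mem_left)]
      exact hgR u (huv ▸ h.swap.mem_left) u' hu'
    · by_cases huv' : u' = v
      · rw [hF₁ u hu, hF₁ u' (huv' ▸ h.mem_left)]
        exact hfR u hu u' (huv' ▸ h.mem_left)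
      · exact hR.not_rel (not_not.1 (h.not_adj u hu huv u' hu' huv')) _ _
  refine hcol ⟨F, fun u hu => ?_, fun u hu u' hu' => ?_⟩
  · rcases h.mem_or_mem hu with hu | hu
    · rw [hF₁ u hu]
      exact hlist f S₁ hf u hu
    · rw [hF₂ u hu]
      exact hlist g S₂ hg u hu
  · rcases h.mem_or_mem hu with hu | hu <;> rcases h.mem_or_mem hu' with hu' | hu'
    · rw [hF₁ u hu, hF₁ u' hu']
      exact hfR u hu u' hu'
    · exact hmix u hu u' hu'
    · exact fun hr => hmix u' hu' u hu (hR.symm _ _ _ _ hr)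
    · rw [hF₂ u hu, hF₂ u' hu']
      exact hgR u hu u' hu'

end IsSplit

/-- An uncolorable degree-list assignment decomposes into tight instances on the blocks. -/
theorem IsConflict.exists_block_lists (hR : IsConflict G R) :
    ∀ (k : ℕ) (S : Finset V) (L : V → Finset C), S.card ≤ k → S.Nonempty →
      ConnOn G.toSimpleGraph S → G.IsDegListOn S L → ¬ HasColoring R S L →
      ∃ LB : Finset V → V → Finset C,
        (∀ B, BlockOf G.toSimpleGraph S B → IsTight G R B (LB B)) ∧
        (∀ B, BlockOf G.toSimpleGraph S B → ∀ u ∈ B, LB B u ⊆ L u) ∧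
        (∀ u ∈ S, ∀ a ∈ L u, ∃ B, BlockOf G.toSimpleGraph S B ∧ u ∈ B ∧ a ∈ LB B u) ∧
        ∀ B B', BlockOf G.toSimpleGraph S B → BlockOf G.toSimpleGraph S B' → B ≠ B' →
          ∀ u ∈ B, u ∈ B' → Disjoint (LB B u) (LB B' u) := by
  intro k
  induction k with
  | zero =>
    intro S L hk hne
    exact absurd hne.card_pos (by omega)
  | succ k ih =>
    intro S L hk hne hS hL hcol
    by_cases hns : NonsepOn G.toSimpleGraph S
    · simp only [hns.blockOf_self_iff]
      refine ⟨fun _ => L, ?_, fun _ _ _ _ => subset_rfl, fun u hu a ha => ⟨S, rfl, hu, ha⟩, ?_⟩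
      · rintro B rfl
        exact ⟨hR, hns, hL, hcol⟩
      · rintro B B' rfl rfl hne
        exact absurd rfl hne
    obtain ⟨v, S₁, S₂, hsp⟩ := hS.exists_split hne hns
    have h₁ := hsp.card_badColors_le hR hL
    have h₂ := hsp.swap.card_badColors_le hR hL
    have hun := hsp.badColors_union hR hcol
    have hdeg := hsp.degOn_add
    have hLv := hL v (hsp.subset_left hsp.mem_left)
    have hcard := Finset.card_union_add_card_inter (badColors R S₁ v L) (badColors R S₂ v L)
    rw [hun] at hcard
    -- The bad colors cover `L v`, yet their numbers add up to at most the degree of `v`, hence at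
    -- most `|L v|`. So they are disjoint, and each side attains its degree bound, as the induction
    -- requires.
    have hdisj : Disjoint (badColors R S₁ v L) (badColors R S₂ v L) :=
      Finset.disjoint_iff_inter_eq_empty.2 (Finset.card_eq_zero.1 (by omega))
    have hlt₁ := hsp.card_left_lt
    have hlt₂ := hsp.swap.card_left_lt
    obtain ⟨LB₁, ht₁, hs₁, hc₁, hd₁⟩ := ih S₁ (Function.update L v (badColors R S₁ v L))
      (by omega) ⟨v, hsp.mem_left⟩ hsp.conn_left (hsp.isDegListOn_update hL (by omega))
      (not_hasColoring_badColors hsp.mem_left)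
    obtain ⟨LB₂, ht₂, hs₂, hc₂, hd₂⟩ := ih S₂ (Function.update L v (badColors R S₂ v L))
      (by omega) ⟨v, hsp.swap.mem_left⟩ hsp.conn_right (hsp.swap.isDegListOn_update hL (by omega))
      (not_hasColoring_badColors hsp.swap.mem_left)
    have hsub : ∀ (T : Finset V) (u : V),
        (Function.update L v (badColors R T v L) : V → Finset C) u ⊆ L u := by
      intro T u
      by_cases huv : u = v
      · subst huv
        rw [Function.update_self]
        exact Finset.filter_subset _ _
      · rw [Function.update_of_ne huv]
    set LB : Finset V → V → Finset C := fun B =>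
      if BlockOf G.toSimpleGraph S₁ B then LB₁ B else LB₂ B with hLB
    have e₁ : ∀ B, BlockOf G.toSimpleGraph S₁ B → LB B = LB₁ B := fun B hB => if_pos hB
    have e₂ : ∀ B, BlockOf G.toSimpleGraph S₂ B → LB B = LB₂ B := fun B hB =>
      if_neg (hsp.swap.not_blockOf_right hB)
    have hmix : ∀ B B', BlockOf G.toSimpleGraph S₁ B → BlockOf G.toSimpleGraph S₂ B' →
        ∀ u ∈ B, u ∈ B' → Disjoint (LB B u) (LB B' u) := by
      intro B B' hB hB' u hu hu'
      obtain rfl := hsp.eq_of_mem (hB.subset hu) (hB'.subset hu')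
      have k₁ := hs₁ B hB u hu
      have k₂ := hs₂ B' hB' u hu'
      rw [Function.update_self] at k₁ k₂
      rw [e₁ B hB, e₂ B' hB']
      exact Finset.disjoint_of_subset_left k₁ (Finset.disjoint_of_subset_right k₂ hdisj)
    refine ⟨LB, fun B hB => ?_, fun B hB u hu => ?_, fun u hu a ha => ?_,
      fun B B' hB hB' hne u hu hu' => ?_⟩
    · rcases hsp.blockOf_iff.1 hB with hB | hB
      · rw [e₁ B hB]
        exact ht₁ B hB
      · rw [e₂ B hB]
        exact ht₂ B hB
    · rcases hsp.blockOf_iff.1 hB with hB | hB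
      · rw [e₁ B hB]
        exact (hs₁ B hB u hu).trans (hsub _ _)
      · rw [e₂ B hB]
        exact (hs₂ B hB u hu).trans (hsub _ _)
    · have : (u ∈ S₁ ∧ a ∈ (Function.update L v (badColors R S₁ v L) : V → Finset C) u) ∨
          (u ∈ S₂ ∧ a ∈ (Function.update L v (badColors R S₂ v L) : V → Finset C) u) := by
        by_cases huv : u = v
        · subst huv
          simp only [Function.update_self]
          rcases Finset.mem_union.1 (hun.ge ha) with h | h
          · exact Or.inl ⟨hsp.mem_left, h⟩
          · exact Or.inr ⟨hsp.swap.mem_left, h⟩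
        · simp only [Function.update_of_ne huv]
          exact (hsp.mem_or_mem hu).imp (fun h => ⟨h, ha⟩) (fun h => ⟨h, ha⟩)
      rcases this with ⟨hu, ha⟩ | ⟨hu, ha⟩
      · obtain ⟨B, hB, huB, haB⟩ := hc₁ u hu a ha
        exact ⟨B, hsp.blockOf_left hB, huB, by rwa [e₁ B hB]⟩
      · obtain ⟨B, hB, huB, haB⟩ := hc₂ u hu a ha
        exact ⟨B, hsp.swap.blockOf_left hB, huB, by rwa [e₂ B hB]⟩
    · rcases hsp.blockOf_iff.1 hB with hB | hB <;> rcases hsp.blockOf_iff.1 hB' with hB' | hB'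
      · rw [e₁ B hB, e₁ B' hB']
        exact hd₁ B B' hB hB' hne u hu hu'
      · exact hmix B B' hB hB' u hu hu'
      · exact (hmix B' B hB' hB u hu' hu).symm
      · rw [e₂ B hB, e₂ B' hB']
        exact hd₂ B B' hB hB' hne u hu hu'

end Blocks

end Multigraph

namespace Multigraph

/-! ### Global conflict structure of tight instances on complete graphs and cycles. -/

section TightCovers

open scoped Classical

variable {V C : Type*} {G : Multigraph V} {R : V → C → V → C → Prop} {L : V → Finset C}
  {S : Finset V} {u v w x y : V} {t : ℕ} {g : V → ℕ}

theorem degOn_of_complete (ht : ∀ x ∈ S, ∀ y ∈ S, x ≠ y → G.mult x y = t) (hu : u ∈ S) :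
    G.degOn S u = t * (S.card - 1) := by
  rw [← G.degOn_erase_add hu, G.loopless, add_zero, degOn, Finset.sum_congr rfl fun v hv =>
    ht u hu v (Finset.mem_of_mem_erase hv) (Finset.ne_of_mem_erase hv).symm, Finset.sum_const,
    Finset.card_erase_of_mem hu, smul_eq_mul, mul_comm]

/-- A numbering of the classes of a function, all of whose classes have the same size. -/
theorem exists_numbering {X Y : Type*} [DecidableEq Y] (D : Finset X) (φ : X → Y) {t k : ℕ} (ht : 1 ≤ t)
    (hD : D.card = t * k) (hφ : ∀ y ∈ D.image φ, (D.filter fun a => φ a = y).card = t) :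
    ∃ ψ : Y → ℕ, Set.InjOn ψ (D.image φ) ∧ (D.image φ).image ψ = Finset.range k := by
  have hk : (D.image φ).card = k := by
    have := Finset.card_eq_sum_card_image φ D
    rw [Finset.sum_congr rfl hφ, Finset.sum_const, smul_eq_mul, hD, mul_comm] at this
    exact (Nat.eq_of_mul_eq_mul_right (by omega) this).symm
  refine ⟨fun y => if hy : y ∈ D.image φ then (Finset.equivFinOfCardEq hk ⟨y, hy⟩ : ℕ) else 0,
    fun y hy z hz hyz => ?_, ?_⟩
  · simp only [Finset.mem_coe] at hy hz
    simp only [hy, hz, dif_pos, Fin.val_inj, EmbeddingLike.apply_eq_iff_eq] at hyz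
    exact congrArg Subtype.val hyz
  · ext i
    rw [Finset.mem_image, Finset.mem_range]
    constructor
    · rintro ⟨y, hy, rfl⟩
      rw [dif_pos hy]
      exact Fin.is_lt _
    · intro hi
      refine ⟨((Finset.equivFinOfCardEq hk).symm ⟨i, hi⟩).1, Subtype.mem _, ?_⟩
      simp

section Complete

theorem IsTight.rel_iff_rel (h : IsTight G R S L)
    (ht : ∀ x ∈ S, ∀ y ∈ S, x ≠ y → G.mult x y = t) (ht1 : 1 ≤ t)
    (hv : v ∈ S) (hx : x ∈ S) (hy : y ∈ S) (hvy : v ≠ y) (hxy : x ≠ y) {a c d : C}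
    (ha : a ∈ L v) (hc : c ∈ L x) (hd : d ∈ L y) (hac : R v a x c) :
    R v a y d ↔ R x c y d := by
  have hcomp : ∀ x ∈ S, ∀ y ∈ S, x ≠ y → G.mult x y ≠ 0 := fun x hx y hy hxy => by
    rw [ht x hx y hy hxy]
    omega
  exact ⟨h.rel_of_complete hcomp hx hy hv hxy ha hc hd hac,
    h.rel_of_complete hcomp hv hy hx hvy hc ha hd (h.isConflict.symm _ _ _ _ hac)⟩

theorem IsTight.conf_eq_conf (h : IsTight G R S L)
    (ht : ∀ x ∈ S, ∀ y ∈ S, x ≠ y → G.mult x y = t) (ht1 : 1 ≤ t)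
    (hv : v ∈ S) (hx : x ∈ S) (hy : y ∈ S) (hvy : v ≠ y) (hxy : x ≠ y) {a c : C}
    (ha : a ∈ L v) (hc : c ∈ L x) (hac : R v a x c) : conf R L v a y = conf R L x c y :=
  Finset.filter_congr fun _ hd => h.rel_iff_rel ht ht1 hv hx hy hvy hxy ha hc hd hac

/-- If `c` and `d` belong to the same vertex, the comparison passes through a color of a third
vertex, which is why `|S| ≥ 3` is needed. -/
theorem IsTight.conf_eq_conf_of_rel (h : IsTight G R S L)
    (ht : ∀ x ∈ S, ∀ y ∈ S, x ≠ y → G.mult x y = t) (ht1 : 1 ≤ t) (h3 : 3 ≤ S.card)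
    (hx : x ∈ S) (hy : y ∈ S) (hv : v ∈ S) (hyx : y ≠ x) (hyv : y ≠ v) {a c d : C}
    (ha : a ∈ L y) (hc : c ∈ L x) (hd : d ∈ L v) (hac : R y a x c) (had : R y a v d) :
    conf R L x c y = conf R L v d y := by
  by_cases hxv : x = v
  · subst hxv
    obtain ⟨z, hz, hzn⟩ : ∃ z ∈ S, z ∉ ({x, y} : Finset V) := by
      by_contra hcon
      push Not at hcon
      have := (Finset.card_le_card (show S ⊆ {x, y} from hcon)).trans Finset.card_le_two
      omega
    simp only [Finset.mem_insert, Finset.mem_singleton, not_or] at hzn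
    obtain ⟨e, he, hae⟩ := h.exists_rel hy hz (by rw [ht y hy z hz (Ne.symm hzn.2)]; omega) ha
    have h1 := (h.rel_iff_rel ht ht1 hy hx hz (Ne.symm hzn.2) (Ne.symm hzn.1) ha hc he hac).1 hae
    have h2 := (h.rel_iff_rel ht ht1 hy hx hz (Ne.symm hzn.2) (Ne.symm hzn.1) ha hd he had).1 hae
    rw [h.conf_eq_conf ht ht1 hx hz hy hyx.symm hzn.2 hc he h1,
      h.conf_eq_conf ht ht1 hx hz hy hyx.symm hzn.2 hd he h2]
  · refine h.conf_eq_conf ht ht1 hx hv hy hyx.symm hyv.symm hc hd ?_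
    exact (h.rel_iff_rel ht ht1 hy hx hv hyv hxv ha hc hd hac).1 had

/-- The conflict graph of a tight instance on a complete multigraph: the colors fall into
`|S| - 1` classes of `t` colors of each vertex, with conflicts exactly inside the classes. -/
theorem IsTight.exists_classes (h : IsTight G R S L)
    (ht : ∀ x ∈ S, ∀ y ∈ S, x ≠ y → G.mult x y = t) (ht1 : 1 ≤ t) :
    ∃ cls : V → C → ℕ, (∀ u ∈ S, ∀ a ∈ L u, cls u a < S.card - 1) ∧
      (∀ u ∈ S, ∀ j < S.card - 1, ((L u).filter fun a => cls u a = j).card = t) ∧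
      ∀ u ∈ S, ∀ v ∈ S, u ≠ v → ∀ a ∈ L u, ∀ b ∈ L v, (R u a v b ↔ cls u a = cls v b) := by
  have hcard : ∀ u ∈ S, (L u).card = t * (S.card - 1) := fun u hu => by
    rw [h.card_eq hu, degOn_of_complete ht hu]
  have hcc : ∀ u ∈ S, ∀ v ∈ S, u ≠ v → ∀ a ∈ L u, (conf R L u a v).card = t :=
    fun u hu v hv huv a ha => by rw [h.card_conf hu hv ha, ht u hu v hv huv]
  -- With one vertex the list is empty. With two vertices each list has `t` colors and all pairs
  -- conflict, so there is a single class.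
  by_cases h3 : S.card ≤ 2
  · refine ⟨fun _ _ => 0, fun u hu a ha => ?_, fun u hu j hj => ?_, fun u hu v hv huv a ha b hb => ?_⟩
    · by_contra hn
      have h1 := hcard u hu
      rw [Nat.eq_zero_of_not_pos hn, mul_zero, Finset.card_eq_zero] at h1
      simp [h1] at ha
    · have hj0 : j = 0 := by omega
      have h2 : S.card - 1 = 1 := by omega
      simp [hj0, hcard u hu, h2]
    · have h2 := Finset.one_lt_card.2 ⟨u, hu, v, hv, huv⟩
      have h2 : S.card - 1 = 1 := by omega
      have := Finset.eq_of_subset_of_card_le (Finset.filter_subset (R u a v) (L v))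
        (by rw [hcard v hv, h2, mul_one]; exact (hcc u hu v hv huv a ha).ge)
      rw [← this] at hb
      simpa using (Finset.mem_filter.1 hb).2
  push Not at h3
  have hR := h.isConflict
  obtain ⟨y, hy⟩ := h.nonsep.1
  have hex : ∀ u ∈ S, ∀ v ∈ S, u ≠ v → ∀ a ∈ L u, ∃ b ∈ L v, R u a v b := fun u hu v hv huv a ha =>
    h.exists_rel hu hv (by rw [ht u hu v hv huv]; omega) ha
  have hex' : ∀ u ∈ S, ∃ v ∈ S, u ≠ v := by
    intro u hu
    obtain ⟨v, hv, hvu⟩ := Finset.exists_mem_ne (by omega : 1 < S.card) u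
    exact ⟨v, hv, hvu.symm⟩
  -- A class is labeled by its set of colors at a fixed vertex `y`. Colors of `y` have no conflicts
  -- inside `y`, so their label is read off in two steps through another vertex.
  set φ : V → C → Finset C := fun u a =>
    if u = y then (L y).filter fun d => ∃ x ∈ S, x ≠ y ∧ ∃ c ∈ L x, R y a x c ∧ R x c y d
    else conf R L u a y with hφ
  have φ_ne : ∀ u a, u ≠ y → φ u a = conf R L u a y := fun u a hu => if_neg hu
  have φ_y : ∀ v ∈ S, v ≠ y → ∀ a ∈ L y, ∀ b ∈ L v, R y a v b → φ y a = conf R L v b y := by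
    intro v hv hvy a ha b hb hab
    simp only [hφ, if_true]
    refine Finset.filter_congr fun d hd => ?_
    constructor
    · rintro ⟨x, hx, hxy, c, hc, hac, hcd⟩
      have := h.conf_eq_conf_of_rel ht ht1 h3 hx hy hv hxy.symm hvy.symm ha hc hb hac hab
      exact (mem_conf.1 (this ▸ mem_conf.2 ⟨hd, hcd⟩)).2
    · intro hr
      exact ⟨v, hv, hvy, b, hb, hab, hr⟩
  have mem_φ : ∀ a ∈ L y, a ∈ φ y a := by
    intro a ha
    obtain ⟨v, hv, hvy⟩ := hex' y hy
    obtain ⟨b, hb, hab⟩ := hex y hy v hv hvy a ha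
    rw [φ_y v hv hvy.symm a ha b hb hab]
    exact mem_conf.2 ⟨ha, hR.symm _ _ _ _ hab⟩
  have key1 : ∀ v ∈ S, v ≠ y → ∀ a ∈ L y, ∀ b ∈ L v, (R y a v b ↔ φ y a = φ v b) := by
    intro v hv hvy a ha b hb
    rw [φ_ne v b hvy]
    refine ⟨φ_y v hv hvy a ha b hb, fun he => ?_⟩
    exact hR.symm _ _ _ _ (mem_conf.1 (he ▸ mem_φ a ha)).2
  have key : ∀ u ∈ S, ∀ v ∈ S, u ≠ v → ∀ a ∈ L u, ∀ b ∈ L v, (R u a v b ↔ φ u a = φ v b) := by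
    intro u hu v hv huv a ha b hb
    by_cases huy : u = y
    · subst huy
      exact key1 v hv huv.symm a ha b hb
    by_cases hvy : v = y
    · subst hvy
      rw [eq_comm, ← key1 u hu huy b hb a ha]
      exact ⟨hR.symm _ _ _ _, hR.symm _ _ _ _⟩
    rw [φ_ne u a huy, φ_ne v b hvy]
    refine ⟨h.conf_eq_conf ht ht1 hu hv hy huy hvy ha hb, fun he => ?_⟩
    obtain ⟨d, hd, had⟩ := hex u hu y hy huy a ha
    have hbd : R v b y d := (mem_conf.1 (he ▸ mem_conf.2 ⟨hd, had⟩)).2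
    exact (h.rel_iff_rel ht ht1 hy hu hv (Ne.symm hvy) huv hd ha hb
      (hR.symm _ _ _ _ had)).1 (hR.symm _ _ _ _ hbd)
  have himg : ∀ u ∈ S, ∀ a ∈ L u, φ u a ∈ (L y).image (φ y) := by
    intro u hu a ha
    by_cases huy : u = y
    · subst huy
      exact Finset.mem_image_of_mem _ ha
    · obtain ⟨d, hd, had⟩ := hex u hu y hy huy a ha
      rw [(key u hu y hy huy a ha d hd).1 had]
      exact Finset.mem_image_of_mem _ hd
  have hfib : ∀ u ∈ S, ∀ X ∈ (L y).image (φ y), ((L u).filter fun a => φ u a = X).card = t := by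
    intro u hu X hX
    obtain ⟨x, hx, hxu, c, hc, rfl⟩ : ∃ x ∈ S, x ≠ u ∧ ∃ c ∈ L x, φ x c = X := by
      obtain ⟨d, hd, rfl⟩ := Finset.mem_image.1 hX
      by_cases huy : u = y
      · subst huy
        obtain ⟨x, hx, hux⟩ := hex' u hu
        obtain ⟨c, hc, hdc⟩ := hex u hu x hx hux d hd
        exact ⟨x, hx, hux.symm, c, hc, ((key u hu x hx hux d hd c hc).1 hdc).symm⟩
      · exact ⟨y, hy, Ne.symm huy, d, hd, rfl⟩
    rw [← hcc x hx u hu hxu c hc]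
    congr 1
    exact Finset.filter_congr fun a ha => by rw [key x hx u hu hxu c hc a ha, eq_comm]
  obtain ⟨ψ, hψ, hψr⟩ := exists_numbering (L y) (φ y) ht1 (hcard y hy) (hfib y hy)
  refine ⟨fun u a => ψ (φ u a), fun u hu a ha => ?_, fun u hu j hj => ?_,
    fun u hu v hv huv a ha b hb => ?_⟩
  · exact Finset.mem_range.1 (hψr.le (Finset.mem_image_of_mem ψ (himg u hu a ha)))
  · obtain ⟨X, hX, rfl⟩ := Finset.mem_image.1 (hψr.ge (Finset.mem_range.2 hj))
    rw [← hfib u hu X hX]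
    congr 1
    exact Finset.filter_congr fun a ha =>
      ⟨fun e => hψ (himg u hu a ha) hX e, fun e => congrArg ψ e⟩
  · rw [key u hu v hv huv a ha b hb]
    exact ⟨fun e => congrArg ψ e, fun e => hψ (himg u hu a ha) (himg v hv b hb) e⟩

end Complete

/-! ### Halves of the lists around a cycle. -/

section Cycle

/-- Every list splits into two halves of size `t`, and each color of a neighboring vertex conflicts
with exactly one of the halves. -/
def HasHalves (G : Multigraph V) (R : V → C → V → C → Prop) (S : Finset V) (L : V → Finset C)
    (t : ℕ) : Prop :=
  ∀ u ∈ S, ∃ A ⊆ L u, A.card = t ∧ (L u \ A).card = t ∧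
    ∀ v ∈ S, G.mult u v ≠ 0 → ∀ c ∈ L v, conf R L v c u = A ∨ conf R L v c u = L u \ A

/-- If the two neighbors of `u` were adjacent, the resulting triangle would be closed by the degree
bound and hence all of `S`. -/
theorem NonsepOn.exists_nonadj_neighbors (hS : NonsepOn G.toSimpleGraph S)
    (hdeg : ∀ v ∈ S, (S.filter (G.toSimpleGraph.Adj v)).card ≤ 2) (h4 : 4 ≤ S.card)
    (hu : u ∈ S) : ∃ w ∈ S, ∃ v ∈ S, w ≠ v ∧ G.mult u w ≠ 0 ∧ G.mult u v ≠ 0 ∧ G.mult w v = 0 ∧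
      ∀ z ∈ S, G.mult u z ≠ 0 → z = w ∨ z = v := by
  have third : ∀ a ∈ S, ∀ p ∈ S, ∀ q ∈ S, p ≠ q → G.mult a p ≠ 0 → G.mult a q ≠ 0 →
      ∀ z ∈ S, G.mult a z ≠ 0 → z = p ∨ z = q := by
    intro a ha p hp q hq hpq hap haq z hz haz
    by_contra hcon
    push Not at hcon
    have hss : ({p, q, z} : Finset V) ⊆ S.filter (G.toSimpleGraph.Adj a) := by
      intro b hb
      simp only [Finset.mem_insert, Finset.mem_singleton] at hb
      rcases hb with rfl | rfl | rfl <;> simp [toSimpleGraph_adj, *]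
    have h1 := Finset.card_le_card hss
    rw [Finset.card_eq_three.2 ⟨p, q, z, hpq, hcon.1.symm, hcon.2.symm, rfl⟩] at h1
    have := hdeg a ha
    omega
  obtain ⟨w, hw, v, hv, hwv, huw, huv⟩ := hS.exists_two_adj (by omega) hu
  rw [toSimpleGraph_adj] at huw huv
  refine ⟨w, hw, v, hv, hwv, huw, huv, ?_, third u hu w hw v hv hwv huw huv⟩
  by_contra hne
  have huw' : u ≠ w := by
    rintro rfl
    exact huw (G.loopless u)
  have huv' : u ≠ v := by
    rintro rfl
    exact huv (G.loopless u)
  have hclosed : ClosedIn G.toSimpleGraph S {u, w, v} := by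
    intro a ha b hb hab
    rw [toSimpleGraph_adj] at hab
    simp only [Finset.mem_insert, Finset.mem_singleton] at ha ⊢
    rcases ha with rfl | rfl | rfl
    · exact Or.inr (third a hu w hw v hv hwv huw huv b hb hab)
    · have := third a hw u hu v hv huv' (by rwa [G.symm]) hne b hb hab
      tauto
    · have := third a hv u hu w hw huw' (by rwa [G.symm]) (by rwa [G.symm]) b hb hab
      tauto
  rcases hS.2.1 {u, w, v} (by simp [Finset.insert_subset_iff, hu, hw, hv]) hclosed with h0 | h0
  · simp at h0
  · have := Finset.card_le_three (a := u) (b := w) (c := v)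
    rw [h0] at this
    omega

/-- The two multiplicities at each vertex agree by `IsTight.exists_halves`, and connectedness
spreads the common value. -/
theorem IsTight.exists_mult_of_degree_le_two (h : IsTight G R S L)
    (hdeg : ∀ v ∈ S, (S.filter (G.toSimpleGraph.Adj v)).card ≤ 2) (h4 : 4 ≤ S.card) :
    ∃ t, 1 ≤ t ∧ ∀ x ∈ S, ∀ y ∈ S, G.mult x y ≠ 0 → G.mult x y = t := by
  have hloc : ∀ u ∈ S, ∀ x ∈ S, ∀ y ∈ S, G.mult u x ≠ 0 → G.mult u y ≠ 0 →
      G.mult u x = G.mult u y := by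
    intro u hu x hx y hy hux huy
    obtain ⟨w, hw, v, hv, hwv, huw, huv, hwv0, hd⟩ := h.nonsep.exists_nonadj_neighbors hdeg h4 hu
    have := (h.exists_halves hw hu hv hwv huw huv hwv0 hd).1
    rcases hd x hx hux with rfl | rfl <;> rcases hd y hy huy with rfl | rfl <;> simp [this]
  obtain ⟨u, hu⟩ := h.nonsep.1
  obtain ⟨v, hv, huv⟩ := h.nonsep.2.1.exists_adj_of_mem hu (by omega)
  rw [toSimpleGraph_adj] at huv
  refine ⟨G.mult u v, Nat.pos_of_ne_zero huv, ?_⟩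
  set A := S.filter fun x => ∀ y ∈ S, G.mult x y ≠ 0 → G.mult x y = G.mult u v with hA
  have hAS : A = S := by
    refine (h.nonsep.2.1 A (Finset.filter_subset _ _) ?_).resolve_left ?_
    · intro a ha b hb hab
      rw [toSimpleGraph_adj] at hab
      obtain ⟨haS, ha⟩ := Finset.mem_filter.1 ha
      refine Finset.mem_filter.2 ⟨hb, fun y hy hby => ?_⟩
      rw [← ha b hb hab, G.symm a b]
      exact hloc b hb y hy a haS hby (by rwa [G.symm])
    · refine Finset.nonempty_iff_ne_empty.1 ⟨u, Finset.mem_filter.2 ⟨hu, fun y hy huy => ?_⟩⟩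
      exact hloc u hu y hy v hv huy huv
  intro x hx
  rw [← hAS] at hx
  exact (Finset.mem_filter.1 hx).2

theorem IsTight.hasHalves_of_degree_le_two (h : IsTight G R S L)
    (hdeg : ∀ v ∈ S, (S.filter (G.toSimpleGraph.Adj v)).card ≤ 2) (h4 : 4 ≤ S.card)
    (hm : ∀ x ∈ S, ∀ y ∈ S, G.mult x y ≠ 0 → G.mult x y = t) : HasHalves G R S L t := by
  intro u hu
  obtain ⟨w, hw, v, hv, hwv, huw, huv, hwv0, hd⟩ := h.nonsep.exists_nonadj_neighbors hdeg h4 hu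
  obtain ⟨-, A, hA, hA1, hA2, hAw, hAv⟩ := h.exists_halves hw hu hv hwv huw huv hwv0 hd
  rw [hm u hu w hw huw] at hA1 hA2
  refine ⟨A, hA, hA1, hA2, fun z hz huz => ?_⟩
  rcases hd z hz huz with rfl | rfl
  · exact hAw
  · exact hAv

/-- A triangle is both complete and a cycle. The degree-two argument fails there because neighbors
are adjacent, so the two classes of the complete case serve as halves. -/
theorem IsTight.hasHalves_of_complete (h : IsTight G R S L)
    (ht : ∀ x ∈ S, ∀ y ∈ S, x ≠ y → G.mult x y = t) (ht1 : 1 ≤ t) (h3 : S.card = 3) :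
    HasHalves G R S L t := by
  obtain ⟨cls, hlt, hfib, hR⟩ := h.exists_classes ht ht1
  rw [h3] at hlt hfib
  intro u hu
  have hcompl : L u \ (L u).filter (fun a => cls u a = 0) = (L u).filter fun a => cls u a = 1 := by
    ext a
    simp only [Finset.mem_sdiff, Finset.mem_filter, not_and]
    constructor
    · rintro ⟨ha, hn⟩
      have := hlt u hu a ha
      have := hn ha
      exact ⟨ha, by omega⟩
    · rintro ⟨ha, hn⟩
      exact ⟨ha, fun _ => by omega⟩
  refine ⟨(L u).filter fun a => cls u a = 0, Finset.filter_subset _ _, hfib u hu 0 (by omega), ?_,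
    fun v hv huv c hc => ?_⟩
  · rw [hcompl]
    exact hfib u hu 1 (by omega)
  · have huv' : v ≠ u := by
      rintro rfl
      exact huv (G.loopless v)
    have hconf : conf R L v c u = (L u).filter fun a => cls u a = cls v c :=
      Finset.filter_congr fun a ha => by rw [hR v hv u hu huv' c hc a ha, eq_comm]
    have := hlt v hv c hc
    rw [hcompl, hconf]
    rcases (by omega : cls v c = 0 ∨ cls v c = 1) with h | h <;> simp [h]

/-- Along an edge, the conflicts are between equal halves or between opposite halves. -/
theorem rel_iff_of_halves (hR : IsConflict G R) {A : V → Finset C} (ht1 : 1 ≤ t)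
    (hA : ∀ u ∈ S, A u ⊆ L u ∧ (A u).card = t ∧ (L u \ A u).card = t ∧
      ∀ v ∈ S, G.mult u v ≠ 0 → ∀ c ∈ L v, conf R L v c u = A u ∨ conf R L v c u = L u \ A u)
    (hu : u ∈ S) (hv : v ∈ S) (huv : G.mult u v ≠ 0) :
    ∃ ε : Prop, ∀ a ∈ L u, ∀ b ∈ L v, (R u a v b ↔ ((a ∈ A u ↔ b ∈ A v) ↔ ε)) := by
  obtain ⟨hu1, hu2, -, hu3⟩ := hA u hu
  obtain ⟨-, -, -, hv3⟩ := hA v hv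
  obtain ⟨a₀, ha₀⟩ := Finset.card_pos.1 (by omega : 0 < (A u).card)
  have conf_iff : ∀ a ∈ L u, ∀ b ∈ L v, (a ∈ conf R L v b u ↔ b ∈ conf R L u a v) := by
    intro a ha b hb
    simp only [mem_conf, ha, hb, true_and]
    exact ⟨hR.symm _ _ _ _, hR.symm _ _ _ _⟩
  -- One color of `A u` decides whether the edge is straight or twisted.
  refine ⟨conf R L u a₀ v = A v, fun a ha b hb => ?_⟩
  have e1 : R u a v b ↔ a ∈ conf R L v b u := by
    rw [conf_iff a ha b hb, mem_conf, and_iff_right hb]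
  have e2 := conf_iff a₀ (hu1 ha₀) b hb
  rw [e1]
  rcases hv3 u hu (by rwa [G.symm]) a₀ (hu1 ha₀) with h | h <;>
    rcases hu3 v hv huv b hb with h' | h' <;>
    rw [h'] at e2 ⊢ <;> rw [h] at e2 <;> simp only [h, Finset.mem_sdiff, ha, hb, hu1 ha₀, ha₀,
      true_and, not_true, true_iff, false_iff, not_not] at e2 ⊢
  · simp [e2]
  · simp [e2]
  · have : ¬ (L v \ A v = A v) := by
      intro heq
      have hb' : b ∈ L v \ A v := Finset.mem_sdiff.2 ⟨hb, e2⟩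
      exact e2 (heq ▸ hb')
    simp [e2, this]
  · have : ¬ (L v \ A v = A v) := by
      intro heq
      have hb' : b ∈ L v \ A v := by rwa [heq]
      exact (Finset.mem_sdiff.1 hb').2 e2
    simp [e2, this]

/-- `a` and `b` are cyclically consecutive with respect to the numbering `g` of `n` vertices. -/
def CycAdj (g : V → ℕ) (n : ℕ) (a b : V) : Prop :=
  g a = g b + 1 ∨ g b = g a + 1 ∨ (g a = 0 ∧ g b + 1 = n) ∨ (g b = 0 ∧ g a + 1 = n)

/-- The conflict graph of a tight instance on a cycle: each list splits into two halves, and the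
conflicts are between halves of the same kind, except that the last and the first vertex of an even
cycle have conflicts between halves of different kinds. -/
theorem IsTight.exists_sides (h : IsTight G R S L) (hh : HasHalves G R S L t) (ht1 : 1 ≤ t)
    (hg : Set.InjOn g S) (h3 : 3 ≤ S.card)
    (hadj : ∀ a ∈ S, ∀ b ∈ S, (G.mult a b ≠ 0 ↔ CycAdj g S.card a b)) :
    ∃ q : V → C → Prop,
      (∀ u ∈ S, ((L u).filter fun a => q u a).card = t ∧ ((L u).filter fun a => ¬ q u a).card = t) ∧
      (∀ u ∈ S, ∀ v ∈ S, g v = g u + 1 → ∀ a ∈ L u, ∀ b ∈ L v, (R u a v b ↔ (q u a ↔ q v b))) ∧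
      ∀ u ∈ S, ∀ v ∈ S, g u + 1 = S.card → g v = 0 → ∀ a ∈ L u, ∀ b ∈ L v,
        (R u a v b ↔ ((q u a ↔ q v b) ↔ Odd S.card)) := by
  have hR := h.isConflict
  choose! A hA using hh
  have hε : ∀ i, ∃ ε : Prop, ∀ u ∈ S, ∀ v ∈ S, g u = i → g v = i + 1 → ∀ a ∈ L u, ∀ b ∈ L v,
      (R u a v b ↔ ((a ∈ A u ↔ b ∈ A v) ↔ ε)) := by
    intro i
    by_cases hex : ∃ u ∈ S, ∃ v ∈ S, g u = i ∧ g v = i + 1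
    · obtain ⟨u, hu, v, hv, hui, hvi⟩ := hex
      obtain ⟨ε, hε⟩ := rel_iff_of_halves hR ht1 hA hu hv
        ((hadj u hu v hv).2 (Or.inr (Or.inl (by omega))))
      refine ⟨ε, fun u' hu' v' hv' hui' hvi' => ?_⟩
      rw [hg hu' hu (by omega), hg hv' hv (by omega)]
      exact hε
    · push Not at hex
      exact ⟨True, fun u hu v hv hui hvi => absurd hvi (hex u hu v hv hui)⟩
  choose ε hε using hε
  obtain ⟨ε', hε'⟩ : ∃ ε : Prop, ∀ u ∈ S, ∀ v ∈ S, g u + 1 = S.card → g v = 0 → ∀ a ∈ L u,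
      ∀ b ∈ L v, (R u a v b ↔ ((a ∈ A u ↔ b ∈ A v) ↔ ε)) := by
    by_cases hex : ∃ u ∈ S, ∃ v ∈ S, g u + 1 = S.card ∧ g v = 0
    · obtain ⟨u, hu, v, hv, hui, hvi⟩ := hex
      obtain ⟨ε, hε⟩ := rel_iff_of_halves hR ht1 hA hu hv
        ((hadj u hu v hv).2 (Or.inr (Or.inr (Or.inr ⟨hvi, hui⟩))))
      refine ⟨ε, fun u' hu' v' hv' hui' hvi' => ?_⟩
      rw [hg hu' hu (by omega), hg hv' hv (by omega)]
      exact hε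
    · push Not at hex
      exact ⟨True, fun u hu v hv hui hvi => absurd hvi (hex u hu v hv hui)⟩
  -- `σ i` records the parity of the twists on the first `i` edges. Swapping halves accordingly
  -- straightens every edge of the path.
  set σ : ℕ → Prop := fun i => Nat.rec True (fun j s => (s ↔ ε j)) i with hσ
  have σ0 : σ 0 := trivial
  have σs : ∀ i, σ (i + 1) = (σ i ↔ ε i) := fun i => rfl
  set q : V → C → Prop := fun u a => (a ∈ A u ↔ σ (g u)) with hq
  have hcount : ∀ u ∈ S, ((L u).filter fun a => q u a).card = t ∧
      ((L u).filter fun a => ¬ q u a).card = t := by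
    intro u hu
    obtain ⟨h1, h2, h3, -⟩ := hA u hu
    have e1 : (L u).filter (fun a => a ∈ A u) = A u := by
      rw [Finset.filter_mem_eq_inter, Finset.inter_eq_right.2 h1]
    have e2 : (L u).filter (fun a => a ∉ A u) = L u \ A u := (Finset.sdiff_eq_filter _ _).symm
    by_cases hs : σ (g u)
    · simp only [hq, hs, iff_true, e1, e2]
      exact ⟨h2, h3⟩
    · simp only [hq, hs, iff_false, not_not, e1, e2]
      exact ⟨h3, h2⟩
  have hstep : ∀ u ∈ S, ∀ v ∈ S, g v = g u + 1 → ∀ a ∈ L u, ∀ b ∈ L v,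
      (R u a v b ↔ (q u a ↔ q v b)) := by
    intro u hu v hv huv a ha b hb
    rw [hε (g u) u hu v hv rfl huv a ha b hb]
    simp only [hq, huv, σs]
    by_cases h1 : a ∈ A u <;> by_cases h2 : b ∈ A v <;> by_cases h3 : σ (g u) <;> simp [h1, h2, h3]
  obtain ⟨δ, hδ⟩ : ∃ δ : Prop, ∀ u ∈ S, ∀ v ∈ S, g u + 1 = S.card → g v = 0 → ∀ a ∈ L u,
      ∀ b ∈ L v, (R u a v b ↔ ((q u a ↔ q v b) ↔ δ)) := by
    refine ⟨(σ (S.card - 1) ↔ ε'), fun u hu v hv hui hvi a ha b hb => ?_⟩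
    rw [hε' u hu v hv hui hvi a ha b hb]
    have hgu : g u = S.card - 1 := by omega
    simp only [hq, hvi, σ0, hgu]
    by_cases h1 : a ∈ A u <;> by_cases h2 : b ∈ A v <;> by_cases h3 : σ (S.card - 1) <;>
      simp [h1, h2, h3]
  suffices hodd : δ ↔ Odd S.card by
    rw [← hodd]
    exact ⟨q, fun u hu => by convert hcount u hu, hstep, hδ⟩
  by_contra hcon
  refine h.not_hasColoring ?_
  -- Alternating sides avoids all conflicts along the path. On the closing edge the sides agree
  -- exactly when the cycle is odd, so the wrong type of closing edge would give a coloring.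
  have hf : ∀ u, ∃ a, u ∈ S → a ∈ L u ∧ (q u a ↔ Even (g u)) := by
    intro u
    by_cases hu : u ∈ S
    · obtain ⟨h1, h2⟩ := hcount u hu
      by_cases he : Even (g u)
      · obtain ⟨a, ha⟩ := Finset.card_pos.1 (by omega : 0 < ((L u).filter fun a => q u a).card)
        exact ⟨a, fun _ => by simpa [he] using ha⟩
      · obtain ⟨a, ha⟩ := Finset.card_pos.1 (by omega : 0 < ((L u).filter fun a => ¬ q u a).card)
        exact ⟨a, fun _ => by simpa [he] using ha⟩
    · obtain ⟨z, hz⟩ := h.nonsep.1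
      obtain ⟨a, -⟩ := Finset.card_pos.1 (by have := (hcount z hz).1; omega :
        0 < ((L z).filter fun a => q z a).card)
      exact ⟨a, fun h => absurd h hu⟩
  choose f hf using hf
  have hnext : ∀ u ∈ S, ∀ v ∈ S, g v = g u + 1 → ¬ R u (f u) v (f v) := by
    intro u hu v hv huv
    rw [hstep u hu v hv huv _ (hf u hu).1 _ (hf v hv).1, (hf u hu).2, (hf v hv).2, huv,
      Nat.even_add_one]
    tauto
  have hlast : ∀ u ∈ S, ∀ v ∈ S, g u + 1 = S.card → g v = 0 → ¬ R u (f u) v (f v) := by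
    intro u hu v hv hui hvi
    rw [hδ u hu v hv hui hvi _ (hf u hu).1 _ (hf v hv).1, (hf u hu).2, (hf v hv).2, hvi]
    rw [← hui, Nat.odd_add_one, Nat.not_odd_iff_even] at hcon
    simp only [Even.zero, iff_true]
    tauto
  refine ⟨f, fun u hu => (hf u hu).1, fun u hu v hv hr => ?_⟩
  have hne : G.mult u v ≠ 0 := fun h0 => hR.not_rel h0 _ _ hr
  rcases (hadj u hu v hv).1 hne with h1 | h1 | ⟨h1, h2⟩ | ⟨h1, h2⟩
  · exact hnext v hv u hu h1 (hR.symm _ _ _ _ hr)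
  · exact hnext u hu v hv h1 hr
  · exact hlast v hv u hu h2 h1 (hR.symm _ _ _ _ hr)
  · exact hlast u hu v hv h2 h1 hr

end Cycle

end TightCovers

end Multigraph

namespace Multigraph

/-! ### Translation between blocks and finite vertex sets; recognition of fat complete graphs and
cycles. -/

section Blocks

open scoped Classical

variable {V : Type*} {G : Multigraph V} {T : Finset V} {n t : ℕ}

theorem isNonseparable_coe : G.IsNonseparable (T : Set V) ↔ NonsepOn G.toSimpleGraph T := by
  unfold IsNonseparable NonsepOn
  rw [SimpleGraph.connected_iff, ← connOn_iff_preconnected]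
  have : ∀ v, ConnOn G.toSimpleGraph (T.erase v) ↔
      (G.toSimpleGraph.induce ((T : Set V) \ {v})).Preconnected := fun v => by
    rw [connOn_iff_preconnected, Finset.coe_erase]
  simp only [Finset.mem_coe, this, Set.nonempty_coe_sort, Finset.coe_nonempty]
  tauto

theorem isBlock_coe [Fintype V] :
    G.IsBlock (T : Set V) ↔ BlockOf G.toSimpleGraph Finset.univ T := by
  constructor
  · intro h
    refine ⟨⟨Finset.subset_univ _, isNonseparable_coe.1 h.prop⟩, fun T' hT' hle => ?_⟩
    exact Finset.coe_subset.1 (h.le_of_ge (isNonseparable_coe.2 hT'.2) (Finset.coe_subset.2 hle))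
  · intro h
    refine ⟨isNonseparable_coe.2 h.nonsep, fun B hB hle => ?_⟩
    lift B to Finset V using B.toFinite
    exact Finset.coe_subset.2
      (h.le_of_ge ⟨Finset.subset_univ _, isNonseparable_coe.1 hB⟩ (Finset.coe_subset.1 hle))

theorem cycleGraph_adj_iff (hn : 3 ≤ n) (i j : Fin n) :
    (SimpleGraph.cycleGraph n).Adj i j ↔ (i : ℕ) = j + 1 ∨ (j : ℕ) = i + 1 ∨
      ((i : ℕ) = 0 ∧ (j : ℕ) + 1 = n) ∨ ((j : ℕ) = 0 ∧ (i : ℕ) + 1 = n) := by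
  have hsub : ∀ a b : Fin n, (a - b).val = 1 ↔
      (a : ℕ) = b + 1 ∨ ((a : ℕ) = 0 ∧ (b : ℕ) + 1 = n) := by
    intro a b
    have ha := a.2
    have hb := b.2
    by_cases hab : b ≤ a
    · rw [Fin.sub_val_of_le hab]
      have : (b : ℕ) ≤ a := hab
      omega
    · rw [Fin.coe_sub_iff_lt.2 (not_le.1 hab)]
      have : (a : ℕ) < b := not_le.1 hab
      omega
  rw [SimpleGraph.cycleGraph_adj', hsub, hsub]
  tauto

theorem cyclePow_mult_of_adj {i j : Fin n} (h : (SimpleGraph.cycleGraph n).Adj i j) :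
    (cyclePow n t).mult i j = t := by
  simp [cyclePow, fatten, ofSimpleGraph, h]

theorem cyclePow_mult_of_not_adj {i j : Fin n} (h : ¬ (SimpleGraph.cycleGraph n).Adj i j) :
    (cyclePow n t).mult i j = 0 := by
  simp [cyclePow, fatten, ofSimpleGraph, h]

theorem isCompleteBlock_iff (h : G.IsCompleteBlock (T : Set V) n t) :
    T.card = n ∧ 1 ≤ t ∧ ∀ x ∈ T, ∀ y ∈ T, x ≠ y → G.mult x y = t := by
  obtain ⟨-, ht, e, he⟩ := h
  refine ⟨?_, ht, fun x hx y hy hxy => ?_⟩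
  · simpa using Fintype.card_congr e
  · have := he ⟨x, hx⟩ ⟨y, hy⟩
    simp only [completePow, fatten, ofSimpleGraph, induce, SimpleGraph.top_adj, ne_eq,
      EmbeddingLike.apply_eq_iff_eq, Subtype.mk.injEq, hxy, not_false_iff, if_true, mul_one] at this
    exact this.symm

theorem isCompleteBlock_of_mult (hT : T.Nonempty) (ht : 1 ≤ t)
    (h : ∀ x ∈ T, ∀ y ∈ T, x ≠ y → G.mult x y = t) :
    G.IsCompleteBlock (T : Set V) T.card t := by
  refine ⟨hT.card_pos, ht, T.equivFin, fun x y => ?_⟩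
  by_cases hxy : x = y
  · subst hxy
    rw [Multigraph.loopless, Multigraph.loopless]
  · have hxy' : x.1 ≠ y.1 := fun e => hxy (Subtype.ext e)
    have := h x.1 x.2 y.1 y.2 hxy'
    have hne : T.equivFin x ≠ T.equivFin y := fun e => hxy (T.equivFin.injective e)
    simp [completePow, fatten, ofSimpleGraph, induce, hne, this]

theorem isCycleBlock_iff (h : G.IsCycleBlock (T : Set V) n t) :
    3 ≤ n ∧ T.card = n ∧ 1 ≤ t ∧ ∃ e : (T : Set V) ≃ Fin n, ∃ g : V → ℕ,
      (∀ x : (T : Set V), g x = e x) ∧ Set.InjOn g T ∧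
      (∀ x ∈ T, ∀ y ∈ T, (G.mult x y ≠ 0 ↔ CycAdj g n x y)) ∧
      ∀ x ∈ T, ∀ y ∈ T, G.mult x y ≠ 0 → G.mult x y = t := by
  obtain ⟨hn, ht, e, he⟩ := h
  have hmult : ∀ x y : (T : Set V), ((SimpleGraph.cycleGraph n).Adj (e x) (e y) ∧
      G.mult x y = t) ∨ (¬ (SimpleGraph.cycleGraph n).Adj (e x) (e y) ∧ G.mult x y = 0) := by
    intro x y
    have h1 : (cyclePow n t).mult (e x) (e y) = G.mult x y := he x y
    by_cases hadj : (SimpleGraph.cycleGraph n).Adj (e x) (e y)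
    · exact Or.inl ⟨hadj, h1 ▸ cyclePow_mult_of_adj hadj⟩
    · exact Or.inr ⟨hadj, h1 ▸ cyclePow_mult_of_not_adj hadj⟩
  set g : V → ℕ := fun v => if hv : v ∈ (T : Set V) then (e ⟨v, hv⟩ : ℕ) else 0 with hg
  have hge : ∀ x : (T : Set V), g x = e x := fun x => dif_pos x.2
  refine ⟨hn, by simpa using Fintype.card_congr e, ht, e, g, hge, fun x hx y hy hxy => ?_,
    fun x hx y hy => ?_, fun x hx y hy hxy => ?_⟩
  · have h1 : g x = e ⟨x, hx⟩ := hge ⟨x, hx⟩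
    have h2 : g y = e ⟨y, hy⟩ := hge ⟨y, hy⟩
    rw [h1, h2, Fin.val_inj, EmbeddingLike.apply_eq_iff_eq] at hxy
    exact congrArg Subtype.val hxy
  · have h1 : g x = e ⟨x, hx⟩ := hge ⟨x, hx⟩
    have h2 : g y = e ⟨y, hy⟩ := hge ⟨y, hy⟩
    have h3 := hmult ⟨x, hx⟩ ⟨y, hy⟩
    rw [CycAdj, h1, h2, ← cycleGraph_adj_iff hn]
    rcases h3 with ⟨h3, h4⟩ | ⟨h3, h4⟩
    · have h5 : G.mult x y ≠ 0 := by
        rw [show G.mult x y = t from h4]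
        omega
      simp only [h3, iff_true]
      exact h5
    · simp [h3, h4]
  · rcases hmult ⟨x, hx⟩ ⟨y, hy⟩ with h3 | h3
    · exact h3.2
    · exact absurd h3.2 hxy

theorem isCycleBlock_of_index (h3 : 3 ≤ T.card) (ht : 1 ≤ t) {g : V → ℕ} (hg : Set.InjOn g T)
    (hlt : ∀ x ∈ T, g x < T.card)
    (hadj : ∀ x ∈ T, ∀ y ∈ T, (G.mult x y ≠ 0 ↔ CycAdj g T.card x y))
    (hm : ∀ x ∈ T, ∀ y ∈ T, G.mult x y ≠ 0 → G.mult x y = t) :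
    G.IsCycleBlock (T : Set V) T.card t := by
  set φ : ↥(T : Set V) → Fin T.card := fun x => ⟨g x, hlt x x.2⟩ with hφ
  have hbij : Function.Bijective φ := by
    rw [Fintype.bijective_iff_injective_and_card]
    refine ⟨fun x y hxy => Subtype.ext (hg x.2 y.2 (congrArg Fin.val hxy)), by simp⟩
  refine ⟨h3, ht, Equiv.ofBijective φ hbij, fun x y => ?_⟩
  have h1 := hadj x x.2 y y.2
  have h2 := hm x x.2 y y.2
  have h4 : (SimpleGraph.cycleGraph T.card).Adj (φ x) (φ y) ↔ CycAdj g T.card x y :=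
    cycleGraph_adj_iff h3 _ _
  change (cyclePow T.card t).mult (φ x) (φ y) = G.mult x y
  by_cases h0 : G.mult x y = 0
  · rw [cyclePow_mult_of_not_adj (by rw [h4, ← h1]; exact not_not.2 h0), h0]
  · rw [cyclePow_mult_of_adj (h4.2 (h1.1 h0)), h2 h0]

/-- The only neighbors of `u` are at the cyclic successor and predecessor of `g u`, distinct because
there are at least three vertices. -/
theorem degOn_of_cycle (h3 : 3 ≤ T.card) {g : V → ℕ} (hg : Set.InjOn g T)
    (hlt : ∀ x ∈ T, g x < T.card)
    (hadj : ∀ x ∈ T, ∀ y ∈ T, (G.mult x y ≠ 0 ↔ CycAdj g T.card x y))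
    (hm : ∀ x ∈ T, ∀ y ∈ T, G.mult x y ≠ 0 → G.mult x y = t) {u : V} (hu : u ∈ T) :
    G.degOn T u = 2 * t := by
  have himg : T.image g = Finset.range T.card := by
    refine Finset.eq_of_subset_of_card_le ?_ ?_
    · intro i hi
      obtain ⟨z, hz, rfl⟩ := Finset.mem_image.1 hi
      exact Finset.mem_range.2 (hlt z hz)
    · rw [Finset.card_range, Finset.card_image_of_injOn hg]
  have hsurj : ∀ i < T.card, ∃ z ∈ T, g z = i := fun i hi => by
    simpa using himg.ge (Finset.mem_range.2 hi)
  have hul := hlt u hu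
  obtain ⟨x, hx, hxg⟩ := hsurj (if g u + 1 = T.card then 0 else g u + 1) (by split_ifs <;> omega)
  obtain ⟨y, hy, hyg⟩ := hsurj (if g u = 0 then T.card - 1 else g u - 1) (by split_ifs <;> omega)
  have hxy : x ≠ y := by
    rintro rfl
    rw [hxg] at hyg
    split_ifs at hyg <;> omega
  have hux : G.mult u x ≠ 0 := by
    rw [hadj u hu x hx, CycAdj]
    split_ifs at hxg <;> omega
  have huy : G.mult u y ≠ 0 := by
    rw [hadj u hu y hy, CycAdj]
    split_ifs at hyg <;> omega
  have : G.degOn T u = ∑ z ∈ {x, y}, G.mult u z := by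
    refine (Finset.sum_subset (by simp [Finset.insert_subset_iff, hx, hy]) fun z hz hzn => ?_).symm
    by_contra hne
    rw [← ne_eq, hadj u hu z hz, CycAdj] at hne
    have hzl := hlt z hz
    simp only [Finset.mem_insert, Finset.mem_singleton, not_or] at hzn
    have h1 : g z ≠ g x := fun e => hzn.1 (hg hz hx e)
    have h2 : g z ≠ g y := fun e => hzn.2 (hg hz hy e)
    split_ifs at hxg hyg <;> omega
  rw [this, Finset.sum_pair hxy, hm u hu x hx hux, hm u hu y hy huy, two_mul]

end Blocks

/-! ### The cover as a conflict relation, and its comparison with the model graphs. -/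

section Covers

open scoped Classical

variable {V C : Type*} {G : Multigraph V} {L : V → Finset C} {T : Finset V} {n k t : ℕ}

namespace MatchingAssignment

variable (M : G.MatchingAssignment L)

/-- The edges of the cover between different cliques, as a relation on all pairs of a vertex and
a color. -/
def conflict (u : V) (c : C) (v : V) (d : C) : Prop :=
  ∃ (hc : c ∈ L u) (hd : d ∈ L v), M.Rel u v ⟨c, hc⟩ ⟨d, hd⟩

/-- Sending each color in conflict with `c` to the index of a matching that contains the edge is
injective, which gives the bound. -/
theorem isConflict : IsConflict G M.conflict where
  symm := fun u c v d ⟨hc, hd, h⟩ => ⟨hd, hc, M.symm u v _ _ h⟩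
  bound := by
    intro u c v D
    obtain ⟨N, hN, hNR⟩ := M.isUnion u v
    have hex : ∀ d ∈ D.filter (M.conflict u c v), ∃ i : Fin (G.mult u v),
        ∃ (hc : c ∈ L u) (hd : d ∈ L v), N i ⟨c, hc⟩ ⟨d, hd⟩ := by
      intro d hd
      obtain ⟨hc, hd, h⟩ := (Finset.mem_filter.1 hd).2
      obtain ⟨i, hi⟩ := (hNR _ _).1 h
      exact ⟨i, hc, hd, hi⟩
    rcases (D.filter (M.conflict u c v)).eq_empty_or_nonempty with h0 | ⟨d, hd⟩
    · simp [h0]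
    have : Nonempty (Fin (G.mult u v)) := ⟨(hex d hd).choose⟩
    choose! i hi using hex
    have := Finset.card_le_card_of_injOn (s := D.filter (M.conflict u c v)) (t := Finset.univ) i
      (fun _ _ => Finset.mem_coe.2 (Finset.mem_univ _)) (by
        intro d hd d' hd' hdd
        obtain ⟨hc, hd1, h1⟩ := hi d hd
        obtain ⟨_, hd2, h2⟩ := hi d' hd'
        rw [hdd] at h1
        exact congrArg Subtype.val ((hN _).2 h1 h2))
    simpa using this

theorem not_conflict_self (u : V) (c d : C) : ¬ M.conflict u c u d :=
  M.isConflict.not_rel (G.loopless u) c d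

theorem cover_adj (x y : Σ u, L u) :
    M.cover.Adj x y ↔ x ≠ y ∧ (x.1 = y.1 ∨ M.conflict x.1 x.2 y.1 y.2) := by
  refine and_congr_right fun _ => or_congr_right ?_
  exact ⟨fun h => ⟨x.2.2, y.2.2, h⟩, fun ⟨_, _, h⟩ => h⟩

/-- An independent set meets each clique at most once, so one with `|V|` elements picks exactly one
color per vertex. -/
theorem colorable_iff [Fintype V] : M.Colorable ↔ HasColoring M.conflict Finset.univ L := by
  constructor
  · rintro ⟨I, hI, hcard⟩
    have hinj : Set.InjOn Sigma.fst (I : Set (Σ u, L u)) := by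
      intro x hx y hy hxy
      by_contra hne
      exact hI hx hy hne ((M.cover_adj x y).2 ⟨hne, Or.inl hxy⟩)
    have himg : I.image Sigma.fst = Finset.univ := by
      rw [← Finset.card_eq_iff_eq_univ, Finset.card_image_of_injOn hinj, hcard]
    have hex : ∀ u, ∃ x ∈ I, x.1 = u := fun u => by
      simpa using himg.ge (Finset.mem_univ u)
    choose x hx hxu using hex
    have hmem : ∀ u, ((x u).2 : C) ∈ L u := by
      have : ∀ (u : V) (y : Σ u, L u), y.1 = u → (y.2 : C) ∈ L u := by
        rintro _ ⟨u, a, ha⟩ rfl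
        exact ha
      exact fun u => this u (x u) (hxu u)
    refine ⟨fun u => (x u).2, fun u _ => hmem u, fun u _ v _ hr => ?_⟩
    have huv : x u ≠ x v := by
      intro e
      have huv : u = v := by rw [← hxu u, ← hxu v, e]
      subst huv
      exact M.not_conflict_self _ _ _ hr
    refine hI (hx u) (hx v) huv ((M.cover_adj _ _).2 ⟨huv, Or.inr ?_⟩)
    convert hr using 1
    exacts [hxu u, hxu v]
  · rintro ⟨f, hf, hfR⟩
    have hinj : Function.Injective
        (fun u => (⟨u, f u, hf u (Finset.mem_univ u)⟩ : Σ u, L u)) :=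
      fun u v h => congrArg Sigma.fst h
    refine ⟨Finset.univ.map ⟨_, hinj⟩, ?_, by simp⟩
    intro x hx y hy hxy hadj
    simp only [Finset.coe_map, Function.Embedding.coeFn_mk, Finset.coe_univ, Set.image_univ,
      Set.mem_range] at hx hy
    obtain ⟨u, rfl⟩ := hx
    obtain ⟨v, rfl⟩ := hy
    rcases ((M.cover_adj _ _).1 hadj).2 with h | h
    · obtain rfl : u = v := h
      exact hxy rfl
    · exact hfR u (Finset.mem_univ u) v (Finset.mem_univ v) h

/-- Colors that fall into `k` classes of size `t` at every vertex of `T` give an isomorphism of the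
induced cover with any graph whose adjacency is described by the classes. -/
theorem induces_of_classes (LB : V → Finset C) (hLB : ∀ u ∈ T, LB u ⊆ L u)
    (e : (T : Set V) ≃ Fin n) (cls : V → C → ℕ) (hlt : ∀ u ∈ T, ∀ a ∈ LB u, cls u a < k)
    (hfib : ∀ u ∈ T, ∀ j < k, ((LB u).filter fun a => cls u a = j).card = t)
    (K : SimpleGraph (Fin n × (Fin k × Fin t)))
    (hK : ∀ x y : (T : Set V), ∀ a ∈ LB x, ∀ b ∈ LB y, ∀ p q : Fin k × Fin t,
      (p.1 : ℕ) = cls x a → (q.1 : ℕ) = cls y b → (e x, p) ≠ (e y, q) →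
        (K.Adj (e x, p) (e y, q) ↔ x = y ∨ M.conflict x a y b)) :
    M.Induces (T : Set V) LB K := by
  -- The third coordinate is an arbitrary enumeration of each class; `exists_numbering` with
  -- singleton classes provides it.
  have hnum : ∀ u j, ∃ r : C → ℕ, u ∈ T → j < k →
      Set.InjOn r ((LB u).filter fun a => cls u a = j) ∧
        ((LB u).filter fun a => cls u a = j).image r = Finset.range t := by
    intro u j
    by_cases h : u ∈ T ∧ j < k
    · obtain ⟨ψ, h1, h2⟩ := exists_numbering ((LB u).filter fun a => cls u a = j) id
        (t := 1) (k := t) le_rfl (by rw [hfib u h.1 j h.2, one_mul]) (by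
          intro a ha
          rw [Finset.image_id] at ha
          rw [Finset.card_eq_one]
          refine ⟨a, ?_⟩
          ext b
          simp only [Finset.mem_filter, id, Finset.mem_singleton] at ha ⊢
          exact ⟨fun hb => hb.2, fun hb => ⟨hb ▸ ha, hb⟩⟩)
      rw [Finset.image_id] at h1 h2
      exact ⟨ψ, fun _ _ => ⟨h1, h2⟩⟩
    · exact ⟨fun _ => 0, fun h1 h2 => absurd ⟨h1, h2⟩ h⟩
  choose r hr using hnum
  have hcls : ∀ x : M.part (T : Set V) LB, cls x.1.1 x.1.2 < k := fun x => hlt _ x.2.1 _ x.2.2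
  have hmem : ∀ x : M.part (T : Set V) LB, (x.1.2 : C) ∈
      (LB x.1.1).filter fun a => cls x.1.1 a = cls x.1.1 x.1.2 := fun x =>
    Finset.mem_filter.2 ⟨x.2.2, rfl⟩
  have hrlt : ∀ x : M.part (T : Set V) LB, r x.1.1 (cls x.1.1 x.1.2) x.1.2 < t := fun x =>
    Finset.mem_range.1 ((hr _ _ x.2.1 (hcls x)).2.le (Finset.mem_image_of_mem _ (hmem x)))
  set φ : M.part (T : Set V) LB → Fin n × (Fin k × Fin t) := fun x =>
    (e ⟨x.1.1, x.2.1⟩, ⟨_, hcls x⟩, ⟨_, hrlt x⟩) with hφ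
  have hinj : Function.Injective φ := by
    rintro ⟨⟨u, a, ha⟩, hu, haB⟩ ⟨⟨v, b, hb⟩, hv, hbB⟩ hxy
    simp only [hφ, Prod.mk.injEq, EmbeddingLike.apply_eq_iff_eq, Subtype.mk.injEq,
      Fin.mk.injEq] at hxy
    obtain ⟨rfl, h1, h2⟩ := hxy
    rw [← h1] at h2
    have hab : a = b := (hr u (cls u a) hu (hlt u hu a haB)).1
      (Finset.mem_coe.2 (Finset.mem_filter.2 ⟨haB, rfl⟩))
      (Finset.mem_coe.2 (Finset.mem_filter.2 ⟨hbB, h1.symm⟩)) h2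
    subst hab
    rfl
  have hsurj : Function.Surjective φ := by
    rintro ⟨i, j, s⟩
    obtain ⟨⟨u, hu⟩, rfl⟩ := e.surjective i
    obtain ⟨a, ha, has⟩ := Finset.mem_image.1
      ((hr u j hu j.2).2.ge (Finset.mem_range.2 s.2))
    obtain ⟨haB, haj⟩ := Finset.mem_filter.1 ha
    refine ⟨⟨⟨u, a, hLB u hu haB⟩, hu, haB⟩, ?_⟩
    simp only [hφ, Prod.mk.injEq, true_and, Fin.ext_iff]
    exact ⟨haj, by rw [haj, has]⟩
  refine ⟨⟨Equiv.ofBijective φ ⟨hinj, hsurj⟩, ?_⟩, fun u hu => ⟨e ⟨u, hu⟩, ?_⟩⟩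
  · intro x y
    rw [SimpleGraph.comap_adj, cover_adj]
    simp only [Function.Embedding.subtype_apply]
    by_cases hxy : x = y
    · subst hxy
      simp
    · have hne : φ x ≠ φ y := fun h => hxy (hinj h)
      have := hK ⟨x.1.1, x.2.1⟩ ⟨y.1.1, y.2.1⟩ _ x.2.2 _ y.2.2 (φ x).2 (φ y).2 rfl rfl hne
      have hne' : x.1 ≠ y.1 := fun h => hxy (Subtype.ext h)
      simp only [Subtype.mk.injEq] at this
      rw [and_iff_right hne', ← this]
      exact Iff.rfl
  · ext p
    constructor
    · rintro ⟨x, hx, rfl⟩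
      simp only [Set.mem_ofPred_eq] at hx
      subst hx
      rfl
    · intro hp
      obtain ⟨x, rfl⟩ := hsurj p
      refine ⟨x, ?_, rfl⟩
      have : e ⟨x.1.1, x.2.1⟩ = e ⟨u, hu⟩ := hp
      exact congrArg Subtype.val (e.injective this)

theorem induces_graphH {LB : V → Finset C} (h : IsTight G M.conflict T LB)
    (hLB : ∀ u ∈ T, LB u ⊆ L u) (hB : G.IsCompleteBlock (T : Set V) n t) :
    M.Induces (T : Set V) LB (graphH n t) := by
  obtain ⟨rfl, ht1, ht⟩ := isCompleteBlock_iff hB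
  obtain ⟨-, -, e, -⟩ := hB
  obtain ⟨cls, hlt, hfib, hcls⟩ := h.exists_classes ht ht1
  refine M.induces_of_classes LB hLB e cls hlt hfib _ fun x y a ha b hb p q hp hq hne => ?_
  rw [graphH, SimpleGraph.fromRel_adj]
  simp only [e.injective.eq_iff, hne, ne_eq, not_false_iff, true_and, eq_comm (a := y),
    eq_comm (a := q.1), or_self]
  by_cases hxy : x = y
  · simp [hxy]
  · have hxy' : x.1 ≠ y.1 := fun e => hxy (Subtype.ext e)
    simp only [hxy, false_or]
    rw [hcls x x.2 y y.2 hxy' a ha b hb, Fin.ext_iff, hp, hq]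

/-- `hK` describes both ladders at once: the closing edges are straight if `n` is odd and crossed if
`n` is even. -/
theorem induces_of_cycle {LB : V → Finset C} (h : IsTight G M.conflict T LB)
    (hLB : ∀ u ∈ T, LB u ⊆ L u) (hB : G.IsCycleBlock (T : Set V) n t)
    (K : SimpleGraph (Fin n × (Fin 2 × Fin t)))
    (hK : ∀ x y, x ≠ y → (K.Adj x y ↔ x.1 = y.1 ∨
      ((y.1 : ℕ) = x.1 + 1 ∧ x.2.1 = y.2.1) ∨ ((x.1 : ℕ) = y.1 + 1 ∧ x.2.1 = y.2.1) ∨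
      ((x.1 : ℕ) + 1 = n ∧ (y.1 : ℕ) = 0 ∧ (x.2.1 = y.2.1 ↔ Odd n)) ∨
      ((y.1 : ℕ) + 1 = n ∧ (x.1 : ℕ) = 0 ∧ (x.2.1 = y.2.1 ↔ Odd n)))) :
    M.Induces (T : Set V) LB K := by
  obtain ⟨h3, rfl, ht1, e, g, hge, hg, hadj, hm⟩ := isCycleBlock_iff hB
  have hlt : ∀ x ∈ T, g x < T.card := fun x hx => by
    have : g x = e ⟨x, hx⟩ := hge ⟨x, hx⟩
    rw [this]
    exact Fin.is_lt _
  have hh : HasHalves G M.conflict T LB t := by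
    by_cases h3' : T.card = 3
    · refine h.hasHalves_of_complete (fun x hx y hy hxy => hm x hx y hy ?_) ht1 h3'
      have hxl := hlt x hx
      have hyl := hlt y hy
      have hxy' : g x ≠ g y := fun e => hxy (hg hx hy e)
      rw [hadj x hx y hy, CycAdj]
      omega
    · refine h.hasHalves_of_degree_le_two (h.complete_or_degree_le_two.resolve_left fun hc => ?_)
        (by omega) hm
      -- On at least four vertices, positions 0 and 2 are not cyclically consecutive, so the block
      -- is not complete.
      have h0 := (e.symm ⟨0, by omega⟩).2
      have h2 := (e.symm ⟨2, by omega⟩).2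
      have e0 : g (e.symm ⟨0, by omega⟩) = 0 := by rw [hge]; simp
      have e2 : g (e.symm ⟨2, by omega⟩) = 2 := by rw [hge]; simp
      have := (hadj _ h0 _ h2).1 (hc _ h0 _ h2 (fun heq => by rw [heq] at e0; omega))
      rw [CycAdj, e0, e2] at this
      omega
  obtain ⟨q, hq, hstep, hlast⟩ := h.exists_sides hh ht1 hg h3 hadj
  have hval : ∀ u a, (if q u a then 0 else 1) = 0 ↔ q u a := fun u a => by
    by_cases hqa : q u a <;> simp [hqa]
  refine M.induces_of_classes LB hLB e (fun u a => if q u a then 0 else 1)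
    (fun u _ a _ => by by_cases hqa : q u a <;> simp [hqa]) (fun u hu j hj => ?_) K
    fun x y a ha b hb p p' hp hp' hne => ?_
  · rcases (by omega : j = 0 ∨ j = 1) with rfl | rfl
    · simpa using (hq u hu).1
    · simpa using (hq u hu).2
  · have hpp : p.1 = p'.1 ↔ (q x a ↔ q y b) := by
      rw [Fin.ext_iff, hp, hp']
      by_cases h1 : q x a <;> by_cases h2 : q y b <;> simp [h1, h2]
    rw [hK _ _ hne]
    simp only [e.injective.eq_iff, hpp, ← hge]
    refine or_congr_right' fun hxy => ?_
    have s1 := fun hs => hstep x x.2 y y.2 hs a ha b hb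
    have s2 := fun hs => hstep y y.2 x x.2 hs b hb a ha
    have s3 := fun hs hs' => hlast x x.2 y y.2 hs hs' a ha b hb
    have s4 := fun hs hs' => hlast y y.2 x x.2 hs hs' b hb a ha
    have hsymm : M.conflict y b x a ↔ M.conflict x a y b :=
      ⟨M.isConflict.symm _ _ _ _, M.isConflict.symm _ _ _ _⟩
    rw [hsymm, iff_comm (a := q y b)] at s2 s4
    constructor
    · rintro (⟨i1, i2⟩ | ⟨i1, i2⟩ | ⟨i1, i2, i3⟩ | ⟨i1, i2, i3⟩)
      · exact (s1 i1).2 i2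
      · exact (s2 i1).2 i2
      · exact (s3 i1 i2).2 i3
      · exact (s4 i1 i2).2 i3
    · intro hr
      have hne0 : G.mult x y ≠ 0 := fun h0 => M.isConflict.not_rel h0 _ _ hr
      rcases (hadj x x.2 y y.2).1 hne0 with i1 | i1 | ⟨i1, i2⟩ | ⟨i1, i2⟩
      · exact Or.inr (Or.inl ⟨i1, (s2 i1).1 hr⟩)
      · exact Or.inl ⟨i1, (s1 i1).1 hr⟩
      · exact Or.inr (Or.inr (Or.inr ⟨i2, i1, (s4 i2 i1).1 hr⟩))
      · exact Or.inr (Or.inr (Or.inl ⟨i2, i1, (s3 i2 i1).1 hr⟩))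

/-- A coloring inside the given lists yields an independent transversal of the model graph. -/
theorem Induces.exists_transversal {M : G.MatchingAssignment L} {LB : V → Finset C} {J : Type*}
    {K : SimpleGraph (Fin n × J)} (h : M.Induces (T : Set V) LB K) (hT : T.card = n)
    (hK : ∀ x y, x ≠ y → x.1 = y.1 → K.Adj x y) {f : V → C} (hfL : ∀ u ∈ T, f u ∈ L u)
    (hf : ∀ u ∈ T, f u ∈ LB u)
    (hfR : ∀ u ∈ T, ∀ v ∈ T, ¬ M.conflict u (f u) v (f v)) :
    ∃ p : Fin n → J, ∀ i j, i ≠ j → ¬ K.Adj (i, p i) (j, p j) := by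
  obtain ⟨e, -⟩ := h
  set x : ↥(T : Set V) → M.part (T : Set V) LB := fun u =>
    ⟨⟨u, f u, hfL u u.2⟩, u.2, hf u u.2⟩ with hx
  have hindep : ∀ u v, u ≠ v → ¬ K.Adj (e (x u)) (e (x v)) := by
    intro u v huv hadj
    have := (M.cover_adj _ _).1 ((e.map_adj_iff).1 hadj)
    rcases this.2 with h | h
    · exact huv (Subtype.ext h)
    · exact hfR u u.2 v v.2 h
  have hinj : Function.Injective fun u => (e (x u)).1 := by
    intro u v huv
    by_contra hne
    refine hindep u v hne (hK _ _ (fun heq => hne ?_) huv)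
    have := e.injective heq
    exact Subtype.ext (congrArg (fun z : M.part (T : Set V) LB => z.1.1) this)
  have hbij : Function.Bijective fun u => (e (x u)).1 := by
    rw [Fintype.bijective_iff_injective_and_card]
    exact ⟨hinj, by simpa using hT⟩
  set w := Equiv.ofBijective _ hbij with hw
  have hwi : ∀ i, (e (x (w.symm i))).1 = i := fun i => w.apply_symm_apply i
  refine ⟨fun i => (e (x (w.symm i))).2, fun i j hij hadj => ?_⟩
  refine hindep (w.symm i) (w.symm j) (fun h => hij (w.symm.injective h)) ?_
  have h1 : e (x (w.symm i)) = (i, (e (x (w.symm i))).2) := Prod.ext (hwi i) rfl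
  have h2 : e (x (w.symm j)) = (j, (e (x (w.symm j))).2) := Prod.ext (hwi j) rfl
  rw [h1, h2]
  exact hadj

end MatchingAssignment

/-- Pigeonhole: `n` rows but only `n - 1` columns. -/
theorem graphH_no_transversal (hn : 1 ≤ n) (p : Fin n → Fin (n - 1) × Fin t) :
    ∃ i j, i ≠ j ∧ (graphH n t).Adj (i, p i) (j, p j) := by
  obtain ⟨i, j, hij, h⟩ := Fintype.exists_ne_map_eq_of_card_lt (fun i => (p i).1)
    (by simp only [Fintype.card_fin]; omega)
  refine ⟨i, j, hij, ?_⟩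
  rw [graphH, SimpleGraph.fromRel_adj]
  exact ⟨fun e => hij (congrArg Prod.fst e), Or.inl (Or.inr h)⟩

/-- Two-colorings along a path are determined by the parity of the position. -/
theorem alternating (hn : 1 ≤ n) (s : Fin n → Fin 2)
    (hs : ∀ i j : Fin n, (j : ℕ) = i + 1 → s i ≠ s j) (i : ℕ) (hi : i < n) :
    s ⟨i, hi⟩ = s ⟨0, hn⟩ ↔ Even i := by
  induction i with
  | zero => simp
  | succ i ih =>
    have h1 := hs ⟨i, by omega⟩ ⟨i + 1, hi⟩ rfl
    rw [Nat.even_add_one, ← ih (by omega)]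
    generalize s ⟨i, by omega⟩ = a at *
    generalize s ⟨i + 1, hi⟩ = b at *
    generalize s ⟨0, hn⟩ = c at *
    omega

/-- Independence forces the sides to alternate, so for odd `n` the last and first rows agree and are
adjacent. -/
theorem fatLadder_no_transversal (hn : 3 ≤ n) (hodd : Odd n) (p : Fin n → Fin 2 × Fin t) :
    ∃ i j, i ≠ j ∧ (fatLadder n t).Adj (i, p i) (j, p j) := by
  by_contra hcon
  push Not at hcon
  have hadj : ∀ i j : Fin n, (j : ℕ) = ((i : ℕ) + 1) % n → i ≠ j → (p i).1 ≠ (p j).1 := by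
    intro i j hij hne heq
    refine hcon i j hne ?_
    rw [fatLadder, SimpleGraph.fromRel_adj]
    exact ⟨fun e => hne (congrArg Prod.fst e), Or.inl (Or.inr ⟨hij, heq⟩)⟩
  have halt := alternating (by omega) (fun i => (p i).1) (fun i j hij => by
    refine hadj i j ?_ ?_
    · rw [hij, Nat.mod_eq_of_lt (by have := j.2; omega)]
    · rintro rfl
      omega) (n - 1) (by omega)
  refine hadj ⟨n - 1, by omega⟩ ⟨0, by omega⟩ ?_ ?_ (halt.2 ?_)
  · simp [Nat.sub_add_cancel (by omega : 1 ≤ n)]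
  · simp only [ne_eq, Fin.mk.injEq]
    omega
  · exact Nat.Odd.sub_odd hodd odd_one

/-- For even `n` alternation makes the last and first rows differ, which is adjacency across the
twist. -/
theorem fatMobiusLadder_no_transversal (hn : 3 ≤ n) (heven : Even n)
    (p : Fin n → Fin 2 × Fin t) :
    ∃ i j, i ≠ j ∧ (fatMobiusLadder n t).Adj (i, p i) (j, p j) := by
  by_contra hcon
  push Not at hcon
  have hadj : ∀ i j : Fin n, i ≠ j → ((j : ℕ) = (i : ℕ) + 1 ∧ (p i).1 = (p j).1) ∨
      ((i : ℕ) + 1 = n ∧ (j : ℕ) = 0 ∧ (p i).1 ≠ (p j).1) → False := by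
    intro i j hne h
    refine hcon i j hne ?_
    rw [fatMobiusLadder, SimpleGraph.fromRel_adj]
    exact ⟨fun e => hne (congrArg Prod.fst e), Or.inl (Or.inr h)⟩
  have halt := alternating (by omega) (fun i => (p i).1) (fun i j hij heq => by
    refine hadj i j ?_ (Or.inl ⟨hij, heq⟩)
    rintro rfl
    omega) (n - 1) (by omega)
  refine hadj ⟨n - 1, by omega⟩ ⟨0, by omega⟩ ?_
    (Or.inr ⟨Nat.sub_add_cancel (by omega), rfl, fun h => ?_⟩)
  · simp only [ne_eq, Fin.mk.injEq]
    omega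
  · have h1 : Odd (n - 1) := Nat.Even.sub_odd (by omega) heven odd_one
    exact Nat.not_even_iff_odd.2 h1 (halt.1 h)

theorem fatLadder_adj_iff (hodd : Odd n) (x y : Fin n × (Fin 2 × Fin t))
    (hxy : x ≠ y) : (fatLadder n t).Adj x y ↔ x.1 = y.1 ∨
      ((y.1 : ℕ) = x.1 + 1 ∧ x.2.1 = y.2.1) ∨ ((x.1 : ℕ) = y.1 + 1 ∧ x.2.1 = y.2.1) ∨
      ((x.1 : ℕ) + 1 = n ∧ (y.1 : ℕ) = 0 ∧ (x.2.1 = y.2.1 ↔ Odd n)) ∨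
      ((y.1 : ℕ) + 1 = n ∧ (x.1 : ℕ) = 0 ∧ (x.2.1 = y.2.1 ↔ Odd n)) := by
  have hmod : ∀ i j : Fin n, (j : ℕ) = ((i : ℕ) + 1) % n ↔
      (j : ℕ) = i + 1 ∨ ((i : ℕ) + 1 = n ∧ (j : ℕ) = 0) := by
    intro i j
    have hi := i.2
    have hj := j.2
    by_cases h : (i : ℕ) + 1 = n
    · rw [h, Nat.mod_self]
      omega
    · rw [Nat.mod_eq_of_lt (by omega)]
      omega
  rw [fatLadder, SimpleGraph.fromRel_adj]
  simp only [hmod, hodd, iff_true, eq_comm (a := y.1), eq_comm (a := y.2.1), and_iff_right hxy]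
  tauto

theorem fatMobiusLadder_adj_iff (heven : Even n) (x y : Fin n × (Fin 2 × Fin t))
    (hxy : x ≠ y) : (fatMobiusLadder n t).Adj x y ↔ x.1 = y.1 ∨
      ((y.1 : ℕ) = x.1 + 1 ∧ x.2.1 = y.2.1) ∨ ((x.1 : ℕ) = y.1 + 1 ∧ x.2.1 = y.2.1) ∨
      ((x.1 : ℕ) + 1 = n ∧ (y.1 : ℕ) = 0 ∧ (x.2.1 = y.2.1 ↔ Odd n)) ∨
      ((y.1 : ℕ) + 1 = n ∧ (x.1 : ℕ) = 0 ∧ (x.2.1 = y.2.1 ↔ Odd n)) := by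
  rw [fatMobiusLadder, SimpleGraph.fromRel_adj]
  simp only [Nat.not_odd_iff_even.2 heven, iff_false, eq_comm (a := y.1), eq_comm (a := y.2.1),
    and_iff_right hxy, ne_eq]
  tauto

/-- A tight instance lives on a fat complete graph or a fat cycle. -/
theorem IsTight.isCompleteBlock_or_isCycleBlock {R : V → C → V → C → Prop}
    (h : IsTight G R T L) :
    ∃ n t, G.IsCompleteBlock (T : Set V) n t ∨ G.IsCycleBlock (T : Set V) n t := by
  rcases h.complete_or_degree_le_two with hc | hd
  · obtain ⟨t, ht1, ht⟩ := h.exists_mult_of_complete hc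
    exact ⟨T.card, t, Or.inl (isCompleteBlock_of_mult h.nonsep.1 ht1 ht)⟩
  by_cases hc : ∀ x ∈ T, ∀ y ∈ T, x ≠ y → G.mult x y ≠ 0
  · obtain ⟨t, ht1, ht⟩ := h.exists_mult_of_complete hc
    exact ⟨T.card, t, Or.inl (isCompleteBlock_of_mult h.nonsep.1 ht1 ht)⟩
  push Not at hc
  obtain ⟨x, hx, y, hy, hxy, hxy0⟩ := hc
  have hcard2 : 2 ≤ T.card := Finset.one_lt_card.2 ⟨x, hx, y, hy, hxy⟩
  obtain ⟨z, hz, hxz⟩ := h.nonsep.2.1.exists_adj_of_mem hx hcard2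
  have hzy : z ≠ y := by
    rintro rfl
    exact hxz hxy0
  have h3 : 3 ≤ T.card := by
    rw [← Finset.card_eq_three.2 ⟨x, y, z, hxy, hxz.ne, hzy.symm, rfl⟩]
    exact Finset.card_le_card (by simp [Finset.insert_subset_iff, hx, hy, hz])
  obtain ⟨g, hg, hlt, hadj⟩ := h.nonsep.exists_cycle_index h3 hd
  -- On three vertices any two are cyclically consecutive, against the nonadjacent pair.
  have h4 : 4 ≤ T.card := by
    by_contra hlt4
    have hne : g x ≠ g y := fun e => hxy (hg hx hy e)
    have h1 := hlt x hx
    have h2 := hlt y hy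
    exact (hadj x hx y hy).2 (by omega) hxy0
  obtain ⟨t, ht1, ht⟩ := h.exists_mult_of_degree_le_two hd h4
  exact ⟨T.card, t, Or.inr (isCycleBlock_of_index h3 ht1 hg hlt hadj ht)⟩

end Covers

end Multigraph

/-! ### The main theorem. -/

theorem theorem1p4 {V C : Type*} [Fintype V] (G : Multigraph V) (hG : G.Connected)
    (L : V → Finset C) (hL : G.IsDegreeList L) (M : G.MatchingAssignment L) :
    ¬ M.Colorable ↔
      (∀ B, G.IsBlock B → ∃ n t, G.IsCompleteBlock B n t ∨ G.IsCycleBlock B n t) ∧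
      ∃ LB : Set V → V → Finset C,
        -- (I) the sets `LB B u` for the blocks `B` containing `u` partition `L u`
        (∀ u,
          (⋃ B ∈ {B | G.IsBlock B ∧ u ∈ B}, (LB B u : Set C)) = (L u : Set C) ∧
          {B | G.IsBlock B ∧ u ∈ B}.PairwiseDisjoint (fun B => LB B u) ∧
          ∀ B, G.IsBlock B → u ∈ B →
            (∀ n t, G.IsCompleteBlock B n t → (LB B u).card = t * (n - 1)) ∧
            (∀ n t, G.IsCycleBlock B n t → (LB B u).card = 2 * t)) ∧
        -- (II)
        (∀ B, G.IsBlock B → ∀ n t, G.IsCompleteBlock B n t →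
          M.Induces B (LB B) (graphH n t)) ∧
        -- (III)
        (∀ B, G.IsBlock B → ∀ n t, G.IsCycleBlock B n t → Odd n →
          M.Induces B (LB B) (fatLadder n t)) ∧
        -- (IV)
        (∀ B, G.IsBlock B → ∀ n t, G.IsCycleBlock B n t → Even n →
          M.Induces B (LB B) (fatMobiusLadder n t)) := by
  classical
  open Multigraph in
  have hconn : ConnOn G.toSimpleGraph Finset.univ := by
    have := hG.preconnected
    intro A _ hc
    rw [or_iff_not_imp_left, ← ne_eq, ← Finset.nonempty_iff_ne_empty]
    rintro ⟨a, ha⟩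
    refine Finset.eq_univ_of_forall fun b => ?_
    obtain ⟨p⟩ := this a b
    induction p with
    | nil => exact ha
    | cons hadj _ ih => exact ih (hc _ ha _ (Finset.mem_univ _) hadj)
  have hne : (Finset.univ : Finset V).Nonempty := by
    obtain ⟨v⟩ := hG.nonempty
    exact ⟨v, Finset.mem_univ v⟩
  rw [M.colorable_iff]
  constructor
  · intro hcol
    obtain ⟨LB, htight, hsub, hcov, hdisj⟩ := M.isConflict.exists_block_lists _ Finset.univ L
      le_rfl hne hconn (fun u _ => hL u) hcol
    refine ⟨fun B hB => ?_, fun B u => LB B.toFinset u, fun u => ⟨?_, ?_, fun B hB hu => ?_⟩,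
      fun B hB n t hBn => ?_, fun B hB n t hBn hn => ?_, fun B hB n t hBn hn => ?_⟩
    · lift B to Finset V using B.toFinite
      exact (htight B (Multigraph.isBlock_coe.1 hB)).isCompleteBlock_or_isCycleBlock
    · ext a
      simp only [Set.mem_iUnion, Set.mem_ofPred_eq, Finset.mem_coe, exists_prop]
      constructor
      · rintro ⟨B, ⟨hB, hu⟩, ha⟩
        lift B to Finset V using B.toFinite
        rw [Finset.toFinset_coe] at ha
        exact hsub B (Multigraph.isBlock_coe.1 hB) u hu ha
      · intro ha
        obtain ⟨B, hB, hu, haB⟩ := hcov u (Finset.mem_univ u) a ha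
        exact ⟨B, ⟨Multigraph.isBlock_coe.2 hB, hu⟩, by rwa [Finset.toFinset_coe]⟩
    · rintro B ⟨hB, hu⟩ B' ⟨hB', hu'⟩ hne
      lift B to Finset V using B.toFinite
      lift B' to Finset V using B'.toFinite
      simp only [Function.onFun, Finset.toFinset_coe]
      exact hdisj B B' (Multigraph.isBlock_coe.1 hB) (Multigraph.isBlock_coe.1 hB')
        (fun h => hne (by rw [h])) u hu hu'
    · lift B to Finset V using B.toFinite
      have ht := htight B (Multigraph.isBlock_coe.1 hB)
      simp only [Finset.toFinset_coe]
      rw [ht.card_eq hu]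
      refine ⟨fun n t hBn => ?_, fun n t hBn => ?_⟩
      · obtain ⟨rfl, -, hm⟩ := Multigraph.isCompleteBlock_iff hBn
        exact Multigraph.degOn_of_complete hm hu
      · obtain ⟨h3, rfl, -, e, g, hge, hg, hadj, hm⟩ := Multigraph.isCycleBlock_iff hBn
        refine Multigraph.degOn_of_cycle h3 hg (fun x hx => ?_) hadj hm hu
        have : g x = e ⟨x, hx⟩ := hge ⟨x, hx⟩
        rw [this]
        exact Fin.is_lt _
    all_goals
      lift B to Finset V using B.toFinite
      have hB' := Multigraph.isBlock_coe.1 hB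
      simp only [Finset.toFinset_coe]
    · exact M.induces_graphH (htight B hB') (hsub B hB') hBn
    · exact M.induces_of_cycle (htight B hB') (hsub B hB') hBn _
        (Multigraph.fatLadder_adj_iff hn)
    · exact M.induces_of_cycle (htight B hB') (hsub B hB') hBn _
        (Multigraph.fatMobiusLadder_adj_iff hn)
  · rintro ⟨hblocks, LB, hI, hII, hIII, hIV⟩ ⟨f, hf, hfR⟩
    -- Each vertex is assigned the block whose list contains its color. The resulting block `T` is
    -- colored entirely from its own lists, which its model graph forbids.
    obtain ⟨T, hT, hfT⟩ := Multigraph.ConnOn.exists_full_block (fun u B => f u ∈ LB B u) _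
      Finset.univ le_rfl hne hconn (by
        intro u hu
        have := (hI u).1.ge (hf u hu)
        simp only [Set.mem_iUnion, Set.mem_ofPred_eq, Finset.mem_coe, exists_prop] at this
        obtain ⟨B, ⟨hB, huB⟩, hfB⟩ := this
        lift B to Finset V using B.toFinite
        exact ⟨B, Multigraph.isBlock_coe.1 hB, huB, hfB⟩)
    have hTB := Multigraph.isBlock_coe.2 hT
    have trans : ∀ {n : ℕ} {J : Type} {K : SimpleGraph (Fin n × J)},
        M.Induces (T : Set V) (LB T) K → T.card = n → (∀ x y, x ≠ y → x.1 = y.1 → K.Adj x y) →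
        ∃ p : Fin n → J, ∀ i j, i ≠ j → ¬ K.Adj (i, p i) (j, p j) := fun h hn hK =>
      h.exists_transversal hn hK (fun u _ => hf u (Finset.mem_univ u)) hfT
        fun u _ v _ => hfR u (Finset.mem_univ u) v (Finset.mem_univ v)
    obtain ⟨n, t, hK | hC⟩ := hblocks T hTB
    · obtain ⟨p, hp⟩ := trans (hII T hTB n t hK) (Multigraph.isCompleteBlock_iff hK).1 (by
        intro x y hne hxy
        rw [graphH, SimpleGraph.fromRel_adj]
        exact ⟨hne, Or.inl (Or.inl hxy)⟩)
      obtain ⟨i, j, hij, hadj⟩ := Multigraph.graphH_no_transversal hK.1 p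
      exact hp i j hij hadj
    · have hcard := (Multigraph.isCycleBlock_iff hC).2.1
      rcases Nat.even_or_odd n with hn | hn
      · obtain ⟨p, hp⟩ := trans (hIV T hTB n t hC hn) hcard (by
          intro x y hne hxy
          rw [fatMobiusLadder, SimpleGraph.fromRel_adj]
          exact ⟨hne, Or.inl (Or.inl hxy)⟩)
        obtain ⟨i, j, hij, hadj⟩ := Multigraph.fatMobiusLadder_no_transversal hC.1 hn p
        exact hp i j hij hadj
      · obtain ⟨p, hp⟩ := trans (hIII T hTB n t hC hn) hcard (by
          intro x y hne hxy
          rw [fatLadder, SimpleGraph.fromRel_adj]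
          exact ⟨hne, Or.inl (Or.inl hxy)⟩)
        obtain ⟨i, j, hij, hadj⟩ := Multigraph.fatLadder_no_transversal hC.1 hn p
        exact hp i j hij hadj
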